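/- Let $\beta>0$, $\upsilon\ge 0$ and $\Delta$ be real numbers. There is a constant $C\ge 0$, depending only on $\beta,\upsilon,\Delta$ (in particular independent of the number of nodes $n$, the number of iterations $T$, the graph, the mixing matrix and the dimension), such that the following holds. **Network.** Let $G$ be a connected graph on $n$ nodes, with uniform node weights $\lambda\equiv\mathbf 1$, and let $W\in\mathbb R^{n\times n}$ be a row-stochastic matrix with $W_{ij}>0$ if $i=j$ or $\{i,j\}$ is an edge of $G$, and $W_{ij}=0$ otherwise, such that either $W$ is symmetric (Strategy I) or the uniform distribution $\mathbf 1^\top/n$ is stationary for $W$ (Strategy II). (This includes the lazy Metropolis–Hastings matrix of $G$.) **Algorithm 1.** For local losses $F_i(\theta)=\mathbb E_{x\sim\mathcal D_i}[f_i(\theta,x)]$ on $\mathbb R^d$ and $F=\frac1n\sum_{i=1}^nF_i$, a common deterministic starting point $\theta_i^{(0)}=\theta^{(0)}$, a step size $\alpha>0$ and mutually independent samples $\xi_i^{(t)}\sim\mathcal D_i$ ($t\ge 0$, $1\le i\le n$), put $g_i^{(t)}=\nabla f_i(\theta_i^{(t)};\xi_i^{(t)})$, $y_i^{(0)}=g_i^{(0)}$,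 and $$\theta_i^{(t+1)}=\sum_{j=1}^nW_{ij}\bigl(\theta_j^{(t)}-\alpha y_j^{(t)}\bigr),\qquad y_i^{(t+1)}=\sum_{j=1}^nW_{ij}y_j^{(t)}+g_i^{(t+1)}-g_i^{(t)},\qquad \bar\theta^{(t)}=\frac1n\sum_{i=1}^n\theta_i^{(t)}.$$ **Claim.** There are step sizes $\alpha_T>0$ ($T\in\mathbb N$) and a function $T_0:\mathbb R\to\mathbb N$, which depend only on $\beta,\upsilon,\Delta,n,G,W$ and on which of the two strategies is used, such that for all $d$, $\mathcal D_i$, $f_i$, $\theta^{(0)}$ as above satisfying 1. each $F_i$ is differentiable with $\|\nabla F_i(\theta)-\nabla F_i(\theta')\|\le\beta\|\theta-\theta'\|$ for all $\theta,\theta'$; 2. $\mathbb E_{x\sim\mathcal D_i}[\nabla f_i(\theta;x)]=\nabla F_i(\theta)$ and $\mathbb E_{x\sim\mathcal D_i}\|\nabla f_i(\theta;x)-\nabla F_i(\theta)\|^2\le\upsilon^2$ for all $i$ and $\theta$; 3. $F(\theta^{(0)})-F(\theta)\le\Delta$ for all $\theta$ (that is, $F(\theta^{(0)})-\inf F\le\Delta$),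 (with $f_i(\theta,\cdot)$ integrable, $f_i(\cdot,x)$ differentiable at $\theta$ for $\mathcal D_i$-almost every $x$, for each $\theta$, and $(\theta,x)\mapsto\nabla f_i(\theta;x)$ measurable), and for every $T\ge T_0\bigl(\frac1n\sum_{i=1}^n\|\nabla F_i(\theta^{(0)})-\nabla F(\theta^{(0)})\|^2\bigr)$, the algorithm run with step size $\alpha=\alpha_T$ satisfies $\mathbb E\|\nabla F(\bar\theta^{(t)})\|^2<\infty$ for $t<T$ and $$\frac1T\sum_{t=0}^{T-1}\mathbb E\bigl[\|\nabla F(\bar\theta^{(t)})\|^2\bigr]\le\frac{C}{\sqrt{nT}}.$$ -/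

import Mathlib

open MeasureTheory ProbabilityTheory

noncomputable section

namespace WeightedGT

/-- The two weighting strategies: `I` uses weighted losses with doubly stochastic mixing,
`II` uses the original losses with `lam`-weighted row-stochastic mixing. -/
inductive Strategy where
  | I
  | II

section Mixing

variable {n : ℕ}

/-- Admissible mixing matrices `W` on the communication graph `G`, for node weights `lam`:
`W` is row-stochastic, its positive entries are exactly the diagonal ones and those on the
edges of `G`; under Strategy I it is moreover symmetric (hence doubly stochastic), under
Strategy II it has the stationary distribution `lam / n`. -/
structure IsMixingMatrix (s : Strategy) (G : SimpleGraph (Fin n)) (lam : Fin n → ℝ)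
    (W : Matrix (Fin n) (Fin n) ℝ) : Prop where
  nonneg : ∀ i j, 0 ≤ W i j
  row_sum : ∀ i, ∑ j, W i j = 1
  pos_iff : ∀ i j, 0 < W i j ↔ (i = j ∨ G.Adj i j)
  balance : match s with
    | Strategy.I => W.IsSymm
    | Strategy.II => Matrix.vecMul (fun i => lam i / n) W = fun i => lam i / n

/-- The diagonal of the gradient-weighting matrix: `diag lam` in Strategy I, the identity in
Strategy II. -/
def gain (s : Strategy) (lam : Fin n → ℝ) : Fin n → ℝ :=
  match s with
  | Strategy.I => lam
  | Strategy.II => fun _ => 1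

open Classical in
/-- The off-diagonal Metropolis-Hastings transition probabilities with target `lam / n`. -/
def mhOff (G : SimpleGraph (Fin n)) (lam : Fin n → ℝ) (i j : Fin n) : ℝ :=
  if G.Adj i j then
    1 / (G.degree i : ℝ) * min 1 (lam j * G.degree i / (lam i * G.degree j))
  else 0

/-- The Metropolis-Hastings matrix `P` with stationary distribution `lam / n`. -/
def mhMatrix (G : SimpleGraph (Fin n)) (lam : Fin n → ℝ) : Matrix (Fin n) (Fin n) ℝ :=
  fun i j => if i = j then 1 - ∑ k, mhOff G lam i k else mhOff G lam i j

/-- The lazy Metropolis-Hastings matrix `(1 - ε) P + ε I`. -/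
def lazyMH (G : SimpleGraph (Fin n)) (ε : ℝ) (lam : Fin n → ℝ) : Matrix (Fin n) (Fin n) ℝ :=
  (1 - ε) • mhMatrix G lam + ε • (1 : Matrix (Fin n) (Fin n) ℝ)

end Mixing

section Gradient

variable {n d : ℕ} {Ξ : Type*}

/-- The stochastic gradient `∇ f_i(θ; x)`, the gradient being taken in `θ`. -/
def stochGrad (f : Fin n → EuclideanSpace ℝ (Fin d) → Ξ → ℝ)
    (i : Fin n) (θ : EuclideanSpace ℝ (Fin d)) (x : Ξ) : EuclideanSpace ℝ (Fin d) :=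
  gradient (fun θ' => f i θ' x) θ

end Gradient

section Problem

variable {n d : ℕ} {Ξ : Type*} [MeasurableSpace Ξ]

/-- The local loss `F_i(θ) = E_{x ∼ D_i} f_i(θ, x)`. -/
def localLoss (D : Fin n → Measure Ξ) (f : Fin n → EuclideanSpace ℝ (Fin d) → Ξ → ℝ)
    (i : Fin n) (θ : EuclideanSpace ℝ (Fin d)) : ℝ :=
  ∫ x, f i θ x ∂(D i)

/-- The global loss `F(θ) = (1/n) ∑ i, lam i * F_i(θ)`. -/
def globalLoss (lam : Fin n → ℝ) (D : Fin n → Measure Ξ)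
    (f : Fin n → EuclideanSpace ℝ (Fin d) → Ξ → ℝ) (θ : EuclideanSpace ℝ (Fin d)) : ℝ :=
  1 / (n : ℝ) * ∑ i, lam i * localLoss D f i θ

/-- The instantaneous losses have expectations, gradients (almost surely, at each point), and
jointly measurable gradient maps. -/
structure IsLossFamily (D : Fin n → Measure Ξ)
    (f : Fin n → EuclideanSpace ℝ (Fin d) → Ξ → ℝ) : Prop where
  integrable : ∀ i θ, Integrable (f i θ) (D i)
  ae_differentiable : ∀ i θ, ∀ᵐ x ∂(D i), DifferentiableAt ℝ (fun θ' => f i θ' x) θ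
  measurable_grad : ∀ i,
    Measurable (fun p : EuclideanSpace ℝ (Fin d) × Ξ => stochGrad f i p.1 p.2)

/-- Every local loss is differentiable and `β`-smooth. -/
structure IsSmoothFamily (β : ℝ) (D : Fin n → Measure Ξ)
    (f : Fin n → EuclideanSpace ℝ (Fin d) → Ξ → ℝ) : Prop where
  differentiable : ∀ i, Differentiable ℝ (localLoss D f i)
  lipschitz : ∀ i θ₁ θ₂,
    ‖gradient (localLoss D f i) θ₁ - gradient (localLoss D f i) θ₂‖ ≤ β * ‖θ₁ - θ₂‖

/-- The stochastic gradients are unbiased with variance at most `υ ^ 2`. -/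
structure IsOracle (υ : ℝ) (D : Fin n → Measure Ξ)
    (f : Fin n → EuclideanSpace ℝ (Fin d) → Ξ → ℝ) : Prop where
  unbiased : ∀ i θ, ∫ x, stochGrad f i θ x ∂(D i) = gradient (localLoss D f i) θ
  integrable_sq : ∀ i θ,
    Integrable (fun x => ‖stochGrad f i θ x - gradient (localLoss D f i) θ‖ ^ 2) (D i)
  variance_le : ∀ i θ,
    ∫ x, ‖stochGrad f i θ x - gradient (localLoss D f i) θ‖ ^ 2 ∂(D i) ≤ υ ^ 2

/-- The dispersion `(1/n) ∑ i, lam i * ‖∇F_i(θ) - ∇F(θ)‖²` of the local gradients at `θ`. -/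
def gradDispersion (lam : Fin n → ℝ) (D : Fin n → Measure Ξ)
    (f : Fin n → EuclideanSpace ℝ (Fin d) → Ξ → ℝ) (θ : EuclideanSpace ℝ (Fin d)) : ℝ :=
  1 / (n : ℝ) *
    ∑ i, lam i * ‖gradient (localLoss D f i) θ - gradient (globalLoss lam D f) θ‖ ^ 2

/-- The samples `ξ t i` (iteration `t`, node `i`) are mutually independent, `ξ t i ∼ D i`. -/
structure IsSampling {Ω : Type*} [MeasurableSpace Ω] (P : Measure Ω) (D : Fin n → Measure Ξ)
    (ξ : ℕ → Fin n → Ω → Ξ) : Prop where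
  measurable : ∀ t i, Measurable (ξ t i)
  law : ∀ t i, Measure.map (ξ t i) P = D i
  indep : iIndepFun (fun p : ℕ × Fin n => ξ p.1 p.2) P

end Problem

section Algorithm

variable {n d : ℕ} {Ξ : Type*}

/-- The states `(Θ^{(t)}, Y^{(t)})` of weighted decentralized gradient tracking, run with mixing
matrix `W`, diagonal gradient weights `g`, step size `α`, common initial point `θ₀`, along the
sample sequence `x` (`x t i` is the sample of node `i` at iteration `t`). -/
def gtState (W : Matrix (Fin n) (Fin n) ℝ) (g : Fin n → ℝ) (α : ℝ)
    (f : Fin n → EuclideanSpace ℝ (Fin d) → Ξ → ℝ) (θ₀ : EuclideanSpace ℝ (Fin d))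
    (x : ℕ → Fin n → Ξ) :
    ℕ → (Fin n → EuclideanSpace ℝ (Fin d)) × (Fin n → EuclideanSpace ℝ (Fin d))
  | 0 => (fun _ => θ₀, fun i => g i • stochGrad f i θ₀ (x 0 i))
  | t + 1 =>
    let Θ := (gtState W g α f θ₀ x t).1
    let Y := (gtState W g α f θ₀ x t).2
    let Θ' : Fin n → EuclideanSpace ℝ (Fin d) := fun i => ∑ j, W i j • (Θ j - α • Y j)
    (Θ', fun i => ∑ j, W i j • Y j +
      g i • (stochGrad f i (Θ' i) (x (t + 1) i) - stochGrad f i (Θ i) (x t i)))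

/-- The network average `(1/n) ∑ i, θ_i^{(t)}` of the algorithm under Strategy `s` and node
weights `lam`. -/
def gtAverage (s : Strategy) (lam : Fin n → ℝ) (W : Matrix (Fin n) (Fin n) ℝ) (α : ℝ)
    (f : Fin n → EuclideanSpace ℝ (Fin d) → Ξ → ℝ) (θ₀ : EuclideanSpace ℝ (Fin d))
    (x : ℕ → Fin n → Ξ) (t : ℕ) : EuclideanSpace ℝ (Fin d) :=
  (1 / (n : ℝ)) • ∑ i, (gtState W (gain s lam) α f θ₀ x t).1 i

end Algorithm

section Metropolis

variable {n : ℕ}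

theorem mhOff_nonneg (G : SimpleGraph (Fin n)) {lam : Fin n → ℝ} (hl : ∀ i, 0 < lam i)
    (i j : Fin n) : 0 ≤ mhOff G lam i j := by
  classical
  unfold mhOff
  split_ifs
  · have := hl i
    have := hl j
    positivity
  · exact le_rfl

theorem mhOff_pos_iff (G : SimpleGraph (Fin n)) {lam : Fin n → ℝ} (hl : ∀ i, 0 < lam i)
    (i j : Fin n) : 0 < mhOff G lam i j ↔ G.Adj i j := by
  classical
  unfold mhOff
  split_ifs with h
  · simp only [h, iff_true]
    have h1 : (0 : ℝ) < G.degree i := by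
      exact_mod_cast (G.degree_pos_iff_exists_adj i).2 ⟨j, h⟩
    have h2 : (0 : ℝ) < G.degree j := by
      exact_mod_cast (G.degree_pos_iff_exists_adj j).2 ⟨i, h.symm⟩
    have := hl i
    have := hl j
    positivity
  · simp [h]

theorem mhOff_self (G : SimpleGraph (Fin n)) (lam : Fin n → ℝ) (i : Fin n) :
    mhOff G lam i i = 0 := by
  simp [mhOff]

theorem mhOff_sum_le (G : SimpleGraph (Fin n)) (lam : Fin n → ℝ) (i : Fin n) :
    ∑ k, mhOff G lam i k ≤ 1 := by
  classical
  have h1 : ∀ k, mhOff G lam i k ≤ if G.Adj i k then 1 / (G.degree i : ℝ) else 0 := by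
    intro k
    unfold mhOff
    by_cases h : G.Adj i k
    · simp only [h, if_true]
      exact mul_le_of_le_one_right (by positivity) (min_le_left _ _)
    · simp [h]
  refine (Finset.sum_le_sum fun k _ => h1 k).trans ?_
  rw [← Finset.sum_filter, Finset.sum_const, nsmul_eq_mul]
  have : (Finset.univ.filter fun k => G.Adj i k).card = G.degree i := by
    rw [← SimpleGraph.card_neighborFinset_eq_degree, SimpleGraph.neighborFinset_eq_filter]
  rw [this, mul_one_div]
  exact div_self_le_one _

theorem mhOff_balance (G : SimpleGraph (Fin n)) {lam : Fin n → ℝ} (hl : ∀ i, 0 < lam i)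
    (i j : Fin n) : lam i * mhOff G lam i j = lam j * mhOff G lam j i := by
  classical
  unfold mhOff
  by_cases h : G.Adj i j
  · simp only [h, h.symm, if_true]
    have h1 : (0 : ℝ) < G.degree i := by
      exact_mod_cast (G.degree_pos_iff_exists_adj i).2 ⟨j, h⟩
    have h2 : (0 : ℝ) < G.degree j := by
      exact_mod_cast (G.degree_pos_iff_exists_adj j).2 ⟨i, h.symm⟩
    have hi := hl i
    have hj := hl j
    rw [← mul_assoc, ← mul_assoc, mul_min_of_nonneg _ _ (by positivity),
      mul_min_of_nonneg _ _ (by positivity), min_comm]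
    congr 1 <;> field_simp
  · have h' : ¬ G.Adj j i := fun h' => h h'.symm
    simp [h, h']

theorem lazyMH_apply_ne (G : SimpleGraph (Fin n)) (ε : ℝ) (lam : Fin n → ℝ) {i j : Fin n}
    (h : i ≠ j) : lazyMH G ε lam i j = (1 - ε) * mhOff G lam i j := by
  simp [lazyMH, mhMatrix, h]

theorem lazyMH_apply_self (G : SimpleGraph (Fin n)) (ε : ℝ) (lam : Fin n → ℝ) (i : Fin n) :
    lazyMH G ε lam i i = (1 - ε) * (1 - ∑ k, mhOff G lam i k) + ε := by
  simp [lazyMH, mhMatrix]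

theorem lazyMH_balance (G : SimpleGraph (Fin n)) (ε : ℝ) {lam : Fin n → ℝ}
    (hl : ∀ i, 0 < lam i) (i j : Fin n) :
    lam i * lazyMH G ε lam i j = lam j * lazyMH G ε lam j i := by
  by_cases h : i = j
  · rw [h]
  · rw [lazyMH_apply_ne G ε lam h, lazyMH_apply_ne G ε lam (Ne.symm h)]
    linear_combination (1 - ε) * mhOff_balance G hl i j

theorem lazyMH_row_sum (G : SimpleGraph (Fin n)) (ε : ℝ) (lam : Fin n → ℝ) (i : Fin n) :
    ∑ j, lazyMH G ε lam i j = 1 := by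
  have h : ∀ j, lazyMH G ε lam i j = (1 - ε) * mhOff G lam i j +
      if i = j then (1 - ε) * (1 - ∑ k, mhOff G lam i k) + ε else 0 := by
    intro j
    by_cases h : i = j
    · subst h
      simp [lazyMH_apply_self, mhOff_self]
    · simp [lazyMH_apply_ne G ε lam h, h]
  simp only [h, Finset.sum_add_distrib, Finset.sum_ite_eq, Finset.mem_univ, if_true,
    ← Finset.mul_sum]
  ring

/-- The lazy Metropolis-Hastings matrix with weights `lam` is admissible in Strategy II, and the
one with unit weights is admissible in Strategy I. -/
theorem isMixingMatrix_lazyMH (s : Strategy) (G : SimpleGraph (Fin n)) {ε : ℝ} (h0 : 0 < ε)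
    (h1 : ε < 1) {lam : Fin n → ℝ} (hl : ∀ i, 0 < lam i) :
    IsMixingMatrix s G lam
      (lazyMH G ε (match s with | Strategy.I => fun _ => 1 | Strategy.II => lam)) := by
  have key : ∀ {mu : Fin n → ℝ}, (∀ i, 0 < mu i) →
      ∀ i j, 0 < lazyMH G ε mu i j ↔ (i = j ∨ G.Adj i j) := by
    intro mu hm i j
    by_cases h : i = j
    · subst h
      have := mul_nonneg (sub_nonneg.2 h1.le) (sub_nonneg.2 (mhOff_sum_le G mu i))
      simp only [true_or, iff_true, lazyMH_apply_self]
      linarith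
    · rw [lazyMH_apply_ne G ε mu h, mul_pos_iff_of_pos_left (sub_pos.2 h1), mhOff_pos_iff G hm]
      simp [h]
  have key2 : ∀ {mu : Fin n → ℝ}, (∀ i, 0 < mu i) → ∀ i j, 0 ≤ lazyMH G ε mu i j := by
    intro mu hm i j
    by_cases h : i = j
    · exact ((key hm i j).2 (Or.inl h)).le
    · rw [lazyMH_apply_ne G ε mu h]
      exact mul_nonneg (sub_nonneg.2 h1.le) (mhOff_nonneg G hm i j)
  cases s with
  | I =>
    have hm : ∀ _ : Fin n, (0 : ℝ) < 1 := fun _ => one_pos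
    refine ⟨key2 hm, lazyMH_row_sum G ε _, key hm, ?_⟩
    ext i j
    simpa using (lazyMH_balance G ε hm j i)
  | II =>
    refine ⟨key2 hl, lazyMH_row_sum G ε _, key hl, ?_⟩
    ext j
    simp only [Matrix.vecMul, dotProduct]
    have : ∀ i, lam i / n * lazyMH G ε lam i j = lam j / n * lazyMH G ε lam j i := by
      intro i
      linear_combination (1 / (n : ℝ)) * lazyMH_balance G ε hl i j
    simp only [this, ← Finset.mul_sum, lazyMH_row_sum, mul_one]

end Metropolis

end WeightedGT

end

/-! Under either strategy with unit weights the columns of `W` also sum to one, so mixing preserves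
averages. Hence the average tracker is the average gradient estimate, and the averaged iterate
performs stochastic gradient descent with step `α`. The only defect is that the local gradients are
evaluated at the separate iterates instead of their average. By smoothness this costs a multiple of
the consensus error, and the work lies in showing that its sum over time carries a factor `α ^ 2`.

Contraction: connectedness and the positive diagonal make `W` a strict contraction on mean-zero
vectors, at a rate independent of the dimension (`exists_consensusError_mix_le`). The consensus
errors of iterates and trackers then satisfy coupled linear recursions, which are summed over time
(`sum_le_of_coupled`, `exists_sum_consensusError_le`). The averaged gradients produced there are
absorbed by the negative term of the descent inequality, which gives a bound valid on every path
(`exists_sum_gradient_sq_le`).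

Probability enters only afterwards. The noise appears on the right through squares and through one
linear term. The linear term has mean zero, and orthogonality across nodes reduces the variance of
the averaged noise to `υ ^ 2 / n` (`exists_sum_integral_gradient_sq_le`).

The resulting mean squared gradient is at most `2Δ/(αT) + βαυ²/n` plus a network-dependent multiple
of `α²`. For `α = √(n/T)` the first two terms are network-free multiples of `1/√(nT)`. The last is
of order `1/T`, hence below `1/√(nT)` for large `T`, so all network dependence goes into `T₀`
(`rate_le`). -/

noncomputable section

namespace WeightedGT

/-! ### Averages and distance to consensus. -/

section Averages

variable {n : ℕ} {E : Type*} [NormedAddCommGroup E] [InnerProductSpace ℝ E]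

/-- The average of the values held by the nodes. -/
def avg (x : Fin n → E) : E := (1 / (n : ℝ)) • ∑ i, x i

/-- The squared distance of `x` to consensus. -/
def consensusError (x : Fin n → E) : ℝ := ∑ i, ‖x i - avg x‖ ^ 2

/-- One round of mixing with `W`. -/
def mix (W : Matrix (Fin n) (Fin n) ℝ) (x : Fin n → E) : Fin n → E := fun i => ∑ j, W i j • x j

theorem consensusError_nonneg (x : Fin n → E) : 0 ≤ consensusError x :=
  Finset.sum_nonneg fun _ _ => sq_nonneg _

theorem avg_add (x y : Fin n → E) : avg (x + y) = avg x + avg y := by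
  simp [avg, Finset.sum_add_distrib]

theorem avg_smul (c : ℝ) (x : Fin n → E) : avg (c • x) = c • avg x := by
  simp [avg, ← Finset.smul_sum, smul_comm c]

theorem avg_sub (x y : Fin n → E) : avg (x - y) = avg x - avg y := by
  simp [avg, Finset.sum_sub_distrib, smul_sub]

theorem avg_const [NeZero n] (c : E) : avg (fun _ : Fin n => c) = c := by
  have : (n : ℝ) ≠ 0 := by exact_mod_cast NeZero.ne n
  simp [avg, ← Nat.cast_smul_eq_nsmul ℝ, smul_smul, this]

theorem sum_sub_avg [NeZero n] (x : Fin n → E) : ∑ i, (x i - avg x) = 0 := by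
  have : (n : ℝ) ≠ 0 := by exact_mod_cast NeZero.ne n
  simp [avg, ← Nat.cast_smul_eq_nsmul ℝ, smul_smul, this]

/-- The mean minimizes the sum of squared distances: deviations from it sum to zero, so the cross
term vanishes. -/
theorem consensusError_le_sum_sq_sub [NeZero n] (x : Fin n → E) (c : E) :
    consensusError x ≤ ∑ i, ‖x i - c‖ ^ 2 := by
  have h : ∀ i, ‖x i - c‖ ^ 2 =
      ‖x i - avg x‖ ^ 2 + 2 * inner ℝ (x i - avg x) (avg x - c) + ‖avg x - c‖ ^ 2 := by
    intro i
    rw [← norm_add_sq_real]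
    simp
  have h2 : ∑ i, inner ℝ (x i - avg x) (avg x - c) = 0 := by
    rw [← sum_inner, sum_sub_avg, inner_zero_left]
  simp only [h, Finset.sum_add_distrib, ← Finset.mul_sum, h2, mul_zero, add_zero]
  exact le_add_of_nonneg_right (Finset.sum_nonneg fun _ _ => sq_nonneg _)

theorem consensusError_le_sum_sq [NeZero n] (x : Fin n → E) :
    consensusError x ≤ ∑ i, ‖x i‖ ^ 2 := by
  simpa using consensusError_le_sum_sq_sub x 0

theorem norm_avg_sq_le [NeZero n] (x : Fin n → E) :
    n * ‖avg x‖ ^ 2 ≤ ∑ i, ‖x i‖ ^ 2 := by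
  have hn : (0 : ℝ) < n := by exact_mod_cast NeZero.pos n
  have h1 : ‖avg x‖ ≤ (1 / (n : ℝ)) * ∑ i, ‖x i‖ := by
    rw [avg, norm_smul, Real.norm_of_nonneg (by positivity)]
    gcongr
    exact norm_sum_le _ _
  have h2 : (∑ i, ‖x i‖) ^ 2 ≤ n * ∑ i, ‖x i‖ ^ 2 := by
    simpa using sq_sum_le_card_mul_sum_sq (s := Finset.univ) (f := fun i => ‖x i‖)
  calc n * ‖avg x‖ ^ 2 ≤ n * ((1 / (n : ℝ)) * ∑ i, ‖x i‖) ^ 2 := by gcongr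
    _ = 1 / n * (∑ i, ‖x i‖) ^ 2 := by field_simp
    _ ≤ 1 / n * (n * ∑ i, ‖x i‖ ^ 2) := by gcongr
    _ = _ := by field_simp

theorem consensusError_smul (c : ℝ) (x : Fin n → E) :
    consensusError (c • x) = c ^ 2 * consensusError x := by
  simp only [consensusError, avg_smul, Pi.smul_apply, ← smul_sub, norm_smul, mul_pow,
    Finset.mul_sum, Real.norm_eq_abs, sq_abs]

theorem norm_add_sq_le_weighted {E : Type*} [NormedAddCommGroup E] {η : ℝ} (hη : 0 < η)
    (a b : E) :
    ‖a + b‖ ^ 2 ≤ (1 + η) * ‖a‖ ^ 2 + (1 + η⁻¹) * ‖b‖ ^ 2 := by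
  have h1 : ‖a + b‖ ^ 2 ≤ (‖a‖ + ‖b‖) ^ 2 := by gcongr; exact norm_add_le a b
  have h2 : 0 ≤ η⁻¹ * (η * ‖a‖ - ‖b‖) ^ 2 := by positivity
  have h3 : η⁻¹ * (η * ‖a‖ - ‖b‖) ^ 2 = η * ‖a‖ ^ 2 - 2 * ‖a‖ * ‖b‖ + η⁻¹ * ‖b‖ ^ 2 := by
    field_simp
    ring
  nlinarith

theorem consensusError_add_le {η : ℝ} (hη : 0 < η) (x y : Fin n → E) :
    consensusError (x + y) ≤ (1 + η) * consensusError x + (1 + η⁻¹) * consensusError y := by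
  simp only [consensusError, Finset.mul_sum, ← Finset.sum_add_distrib]
  refine Finset.sum_le_sum fun i _ => ?_
  have : (x + y) i - avg (x + y) = (x i - avg x) + (y i - avg y) := by
    rw [avg_add, Pi.add_apply]
    abel
  rw [this]
  exact norm_add_sq_le_weighted hη _ _

end Averages

/-! ### Spectral gap of the mixing matrix. -/

section Contraction

variable {n : ℕ} {s : Strategy} {G : SimpleGraph (Fin n)} {W : Matrix (Fin n) (Fin n) ℝ}

/-- From here on the two strategies need no separate treatment of `W`: symmetry and uniform
stationarity both yield double stochasticity. -/
theorem IsMixingMatrix.col_sum (hW : IsMixingMatrix s G (fun _ => 1) W) (j : Fin n) :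
    ∑ i, W i j = 1 := by
  have hb := hW.balance
  cases s with
  | I =>
    rw [← hW.row_sum j]
    exact Finset.sum_congr rfl fun i _ => by
      simpa using (congrFun (congrFun (show W.transpose = W from hb) j) i)
  | II =>
    have hn : (n : ℝ) ≠ 0 := by
      have := j.pos
      positivity
    have h := congrFun hb j
    simp only [Matrix.vecMul, dotProduct, ← Finset.mul_sum] at h
    field_simp at h
    exact h

/-- Each row of `W` is a probability vector, and the inner sum on the left is the variance of `x`
under it. Summing second moment minus squared mean over the rows, the column sums turn the second
moments into the squared norm of `x`. -/
theorem mix_variance (hW : IsMixingMatrix s G (fun _ => 1) W) (x : Fin n → ℝ) :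
    ∑ i, ∑ j, W i j * (x j - ∑ k, W i k * x k) ^ 2 =
      ∑ j, x j ^ 2 - ∑ i, (∑ j, W i j * x j) ^ 2 := by
  have h : ∀ i, ∑ j, W i j * (x j - ∑ k, W i k * x k) ^ 2 =
      ∑ j, W i j * x j ^ 2 - (∑ j, W i j * x j) ^ 2 := by
    intro i
    set m := ∑ k, W i k * x k with hm
    have : ∀ j, W i j * (x j - m) ^ 2 = W i j * x j ^ 2 - 2 * m * (W i j * x j) + m ^ 2 * W i j := by
      intro j
      ring
    simp only [this, Finset.sum_add_distrib, Finset.sum_sub_distrib, ← Finset.mul_sum,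
      hW.row_sum, ← hm]
    ring
  simp only [h, Finset.sum_sub_distrib]
  rw [Finset.sum_comm]
  simp only [← Finset.sum_mul, hW.col_sum, one_mul]

/-- If no norm is lost, every row variance vanishes. As the diagonal and edge entries are positive,
node `i` and its neighbours all carry the mean of row `i`; thus `x` is constant along edges, hence
constant, hence zero. -/
theorem eq_zero_of_sum_sq_mix_ge (hG : G.Connected) (hW : IsMixingMatrix s G (fun _ => 1) W)
    {x : Fin n → ℝ} (hx : ∑ i, x i = 0) (h : ∑ j, x j ^ 2 ≤ ∑ i, (∑ j, W i j * x j) ^ 2) :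
    x = 0 := by
  have hnn : ∀ i j, 0 ≤ W i j * (x j - ∑ k, W i k * x k) ^ 2 := fun i j =>
    mul_nonneg (hW.nonneg i j) (sq_nonneg _)
  have hz : ∀ i j, W i j * (x j - ∑ k, W i k * x k) ^ 2 = 0 := by
    intro i j
    have h0 : ∑ i, ∑ j, W i j * (x j - ∑ k, W i k * x k) ^ 2 = 0 :=
      le_antisymm (by rw [mix_variance hW]; linarith)
        (Finset.sum_nonneg fun i _ => Finset.sum_nonneg fun j _ => hnn i j)
    rw [Finset.sum_eq_zero_iff_of_nonneg
      fun i _ => Finset.sum_nonneg fun j _ => hnn i j] at h0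
    have h1 := h0 i (Finset.mem_univ i)
    rw [Finset.sum_eq_zero_iff_of_nonneg fun j _ => hnn i j] at h1
    exact h1 j (Finset.mem_univ j)
  have hpos : ∀ i j, 0 < W i j → x j = ∑ k, W i k * x k := by
    intro i j hij
    rcases mul_eq_zero.1 (hz i j) with h | h
    · exact absurd h hij.ne'
    · exact sub_eq_zero.1 (pow_eq_zero_iff two_ne_zero |>.1 h)
  have hadj : ∀ i j, G.Adj i j → x i = x j := fun i j hij =>
    (hpos i i ((hW.pos_iff i i).2 (Or.inl rfl))).trans
      (hpos i j ((hW.pos_iff i j).2 (Or.inr hij))).symm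
  have hall : ∀ i j, x i = x j := by
    intro i j
    obtain ⟨p⟩ := hG.preconnected i j
    induction p with
    | nil => rfl
    | cons hij _ ih => exact (hadj _ _ hij).trans ih
  funext i
  have h2 : (n : ℝ) * x i = 0 := by
    rw [← hx, Finset.sum_congr rfl fun j _ => hall j i]
    simp
  have hn : (n : ℝ) ≠ 0 := by
    have := i.pos
    positivity
  simpa [hn] using h2

/-- Compactness of the unit sphere in the mean-zero hyperplane upgrades the strict inequality to a
uniform factor; homogeneity extends it to all mean-zero vectors. -/
theorem exists_sum_sq_mix_le (hG : G.Connected) (hW : IsMixingMatrix s G (fun _ => 1) W) :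
    ∃ r : ℝ, 0 < r ∧ r < 1 ∧ ∀ x : Fin n → ℝ, ∑ i, x i = 0 →
      ∑ i, (∑ j, W i j * x j) ^ 2 ≤ r * ∑ i, x i ^ 2 := by
  let S : Set (Fin n → ℝ) := {x | ∑ i, x i = 0 ∧ ∑ i, x i ^ 2 = 1}
  have hS : IsCompact S := by
    refine Metric.isCompact_of_isClosed_isBounded ?_ ?_
    · exact (isClosed_eq (by fun_prop) continuous_const).inter
        (isClosed_eq (by fun_prop) continuous_const)
    · refine (Metric.isBounded_closedBall (x := (0 : Fin n → ℝ)) (r := 1)).subset ?_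
      rintro x ⟨-, hx⟩
      rw [mem_closedBall_zero_iff, pi_norm_le_iff_of_nonneg zero_le_one]
      intro i
      rw [Real.norm_eq_abs, ← sq_le_one_iff_abs_le_one, ← hx]
      exact Finset.single_le_sum (f := fun i => x i ^ 2) (fun _ _ => sq_nonneg _)
        (Finset.mem_univ i)
  have hunit : ∃ r : ℝ, 0 < r ∧ r < 1 ∧ ∀ x ∈ S, ∑ i, (∑ j, W i j * x j) ^ 2 ≤ r := by
    rcases S.eq_empty_or_nonempty with he | hne
    -- With a single node the mean-zero sphere is empty.
    · exact ⟨1 / 2, by norm_num, by norm_num, by simp [he]⟩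
    obtain ⟨y, hy, hmax⟩ := hS.exists_isMaxOn hne
      (f := fun x : Fin n → ℝ => ∑ i, (∑ j, W i j * x j) ^ 2) (by fun_prop)
    have hlt : ∑ i, (∑ j, W i j * y j) ^ 2 < 1 := by
      by_contra! hge
      have := eq_zero_of_sum_sq_mix_ge hG hW hy.1 (hy.2.trans_le hge)
      have h1 := hy.2
      simp [this] at h1
    -- The floor `1 / 2` keeps the rate positive, since `r` is later a denominator.
    exact ⟨max (1 / 2) (∑ i, (∑ j, W i j * y j) ^ 2), by positivity,
      max_lt (by norm_num) hlt, fun x hx => (hmax hx).trans (le_max_right _ _)⟩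
  obtain ⟨r, h0, h1, hr⟩ := hunit
  refine ⟨r, h0, h1, fun x hx => ?_⟩
  rcases (Finset.sum_nonneg fun i _ => sq_nonneg (x i) :
    0 ≤ ∑ i, x i ^ 2).eq_or_lt with hz | hpos
  · have : x = 0 := by
      funext i
      have := (Finset.sum_eq_zero_iff_of_nonneg fun i _ => sq_nonneg (x i)).1 hz.symm i
        (Finset.mem_univ i)
      simpa using this
    simp [this]
  · set N := ∑ i, x i ^ 2
    have hs : (Real.sqrt N)⁻¹ ^ 2 = N⁻¹ := by rw [inv_pow, Real.sq_sqrt hpos.le]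
    have h := hr ((Real.sqrt N)⁻¹ • x) ⟨by simp [← Finset.mul_sum, hx], by
      simp only [Pi.smul_apply, smul_eq_mul, mul_pow, ← Finset.mul_sum, hs]
      exact inv_mul_cancel₀ hpos.ne'⟩
    have hc : ∀ i, ∑ j, W i j * ((Real.sqrt N)⁻¹ • x) j = (Real.sqrt N)⁻¹ * ∑ j, W i j * x j := by
      intro i
      rw [Finset.mul_sum]
      exact Finset.sum_congr rfl fun j _ => mul_left_comm _ _ _
    simp only [hc, mul_pow, ← Finset.mul_sum, hs] at h
    rwa [inv_mul_le_iff₀ hpos, mul_comm] at h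

theorem avg_mix {E : Type*} [NormedAddCommGroup E] [InnerProductSpace ℝ E]
    (hW : IsMixingMatrix s G (fun _ => 1) W) (x : Fin n → E) : avg (mix W x) = avg x := by
  simp only [avg, mix]
  rw [Finset.sum_comm]
  simp only [← Finset.sum_smul, hW.col_sum, one_smul]

theorem mix_add {E : Type*} [NormedAddCommGroup E] [InnerProductSpace ℝ E] (x y : Fin n → E) :
    mix W (x + y) = mix W x + mix W y := by
  funext i
  simp [mix, Finset.sum_add_distrib]

theorem mix_smul {E : Type*} [NormedAddCommGroup E] [InnerProductSpace ℝ E] (c : ℝ)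
    (x : Fin n → E) : mix W (c • x) = c • mix W x := by
  funext i
  simp [mix, Finset.smul_sum, smul_comm c]

/-- Mixing contracts the distance to consensus, at a rate independent of the dimension. -/
theorem exists_consensusError_mix_le (hG : G.Connected)
    (hW : IsMixingMatrix s G (fun _ => 1) W) :
    ∃ r : ℝ, 0 < r ∧ r < 1 ∧ ∀ (d : ℕ) (x : Fin n → EuclideanSpace ℝ (Fin d)),
      consensusError (mix W x) ≤ r * consensusError x := by
  obtain ⟨r, h0, h1, hr⟩ := exists_sum_sq_mix_le hG hW
  have : NeZero n := ⟨by
    obtain ⟨i⟩ := hG.nonempty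
    exact i.pos.ne'⟩
  refine ⟨r, h0, h1, fun d x => ?_⟩
  have hdev : ∀ i, mix W x i - avg (mix W x) = ∑ j, W i j • (x j - avg x) := by
    intro i
    simp only [avg_mix hW, smul_sub, Finset.sum_sub_distrib, ← Finset.sum_smul, hW.row_sum,
      one_smul, mix]
  simp only [consensusError, hdev]
  simp only [EuclideanSpace.norm_sq_eq, Real.norm_eq_abs, sq_abs]
  -- `W` acts on each coordinate separately, so the scalar bound applies coordinatewise with the
  -- same `r` for every `d`.
  rw [Finset.sum_comm, Finset.sum_comm (γ := Fin n), Finset.mul_sum]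
  refine Finset.sum_le_sum fun k _ => ?_
  have hz : ∑ i, (x i - avg x) k = 0 := by
    have := congrArg (fun v : EuclideanSpace ℝ (Fin d) => v k) (sum_sub_avg x)
    simpa using this
  simpa using hr (fun i => (x i - avg x) k) hz

theorem exists_consensusError_mix_add_le (hG : G.Connected)
    (hW : IsMixingMatrix s G (fun _ => 1) W) :
    ∃ q K : ℝ, 0 < q ∧ q < 1 ∧ 0 < K ∧ ∀ (d : ℕ) (x y : Fin n → EuclideanSpace ℝ (Fin d)),
      consensusError (mix W x + y) ≤ q * consensusError x + K * consensusError y := by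
  obtain ⟨r, h0, h1, hr⟩ := exists_consensusError_mix_le hG hW
  -- This Young parameter makes `(1 + η) * r = (1 + r) / 2`, halfway between `r` and `1`.
  have hη : 0 < (1 - r) / (2 * r) := div_pos (by linarith) (by linarith)
  refine ⟨(1 + r) / 2, 1 + ((1 - r) / (2 * r))⁻¹, by linarith, by linarith, by positivity,
    fun d x y => (consensusError_add_le hη _ _).trans (add_le_add ?_ le_rfl)⟩
  calc (1 + (1 - r) / (2 * r)) * consensusError (mix W x)
      ≤ (1 + (1 - r) / (2 * r)) * (r * consensusError x) := by
        gcongr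
        exact hr d x
    _ = _ := by
        field_simp
        ring

end Contraction

/-! ### Summation of linear recursions. -/

section Recursion

theorem sum_le_of_contraction {q : ℝ} {u v : ℕ → ℝ} (hu : ∀ t, 0 ≤ u t)
    (h : ∀ t, u (t + 1) ≤ q * u t + v t) (T : ℕ) :
    (1 - q) * ∑ t ∈ Finset.range T, u t ≤ u 0 + ∑ t ∈ Finset.range T, v t := by
  have h1 : ∑ t ∈ Finset.range T, u (t + 1) ≤
      q * ∑ t ∈ Finset.range T, u t + ∑ t ∈ Finset.range T, v t := by
    rw [Finset.mul_sum, ← Finset.sum_add_distrib]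
    exact Finset.sum_le_sum fun t _ => h t
  have h2 := Finset.sum_range_succ' u T
  rw [Finset.sum_range_succ] at h2
  linarith [hu T]

/-- Summing the coupled recursions of the consensus error `A` and the tracking error `B`. -/
theorem sum_le_of_coupled {q K L a : ℝ} (hq : q < 1) (hK : 0 < K) (hL : 0 < L) (ha : 0 ≤ a)
    (hsmall : a * (L * K + (1 - q) * L) ≤ (1 - q) ^ 2 / 2) {A B H N : ℕ → ℝ}
    (hA : ∀ t, 0 ≤ A t) (hB : ∀ t, 0 ≤ B t) (hH : ∀ t, 0 ≤ H t) (hN : ∀ t, 0 ≤ N t)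
    (hA0 : A 0 = 0) (hArec : ∀ t, A (t + 1) ≤ q * A t + K * (a * B t))
    (hBrec : ∀ t, B (t + 1) ≤ q * B t + L * (A t + a * B t + a * H t + N t + N (t + 1)))
    (T : ℕ) :
    ∑ t ∈ Finset.range T, A t ≤ 2 * K * (1 + 2 * L) / (1 - q) ^ 2 * a *
      (B 0 + a * ∑ t ∈ Finset.range T, H t + ∑ t ∈ Finset.range (T + 1), N t) := by
  have hp : 0 < 1 - q := by linarith
  have h1 := sum_le_of_contraction hA hArec T
  have h2 := sum_le_of_contraction hB hBrec T
  simp only [← Finset.mul_sum, Finset.sum_add_distrib] at h1 h2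
  have hN1 : ∑ t ∈ Finset.range T, N t ≤ ∑ t ∈ Finset.range (T + 1), N t := by
    rw [Finset.sum_range_succ]
    linarith [hN T]
  have hN2 : ∑ t ∈ Finset.range T, N (t + 1) ≤ ∑ t ∈ Finset.range (T + 1), N t := by
    rw [Finset.sum_range_succ']
    linarith [hN 0]
  have hSA := Finset.sum_nonneg fun t (_ : t ∈ Finset.range T) => hA t
  have hSB := Finset.sum_nonneg fun t (_ : t ∈ Finset.range T) => hB t
  have hSH := Finset.sum_nonneg fun t (_ : t ∈ Finset.range T) => hH t
  have hSN := Finset.sum_nonneg fun t (_ : t ∈ Finset.range (T + 1)) => hN t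
  have hB0 := hB 0
  rw [hA0, zero_add] at h1
  generalize ∑ t ∈ Finset.range T, A t = SA at *
  generalize ∑ t ∈ Finset.range T, B t = SB at *
  generalize ∑ t ∈ Finset.range T, H t = SH at *
  generalize ∑ t ∈ Finset.range (T + 1), N t = SN at *
  generalize ∑ t ∈ Finset.range T, N t = SN1 at *
  generalize ∑ t ∈ Finset.range T, N (t + 1) = SN2 at *
  generalize 1 - q = p at *
  have h3 : p * SB ≤ B 0 + L * (SA + a * SB + a * SH + 2 * SN) := by
    refine h2.trans ?_
    gcongr B 0 + L * ?_
    linarith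
  have h4 : p ^ 2 / 2 * SB ≤ p * (B 0 + L * (a * SH) + 2 * L * SN) := by
    -- The extra factor `p` allows `p * SA` to be replaced by `K * (a * SB)`; `hsmall` then absorbs
    -- half of `p ^ 2 * SB`.
    have e1 : p * (p * SB) ≤ p * (B 0 + L * (SA + a * SB + a * SH + 2 * SN)) := by gcongr
    have e2 : L * (p * SA) ≤ L * (K * (a * SB)) := by gcongr
    have e3 : a * (L * K + p * L) * SB ≤ p ^ 2 / 2 * SB := by gcongr
    linarith
  have h5 : SB ≤ 2 / p * (B 0 + L * (a * SH) + 2 * L * SN) := by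
    rw [← mul_le_mul_iff_right₀ (by positivity : 0 < p ^ 2 / 2)]
    refine h4.trans (le_of_eq ?_)
    field_simp
  have h6 : B 0 + L * (a * SH) + 2 * L * SN ≤ (1 + 2 * L) * (B 0 + a * SH + SN) := by
    have : 0 ≤ a * SH := by positivity
    have : 0 ≤ L * B 0 := by positivity
    have : 0 ≤ L * (a * SH) := by positivity
    linarith
  calc SA = 1 / p * (p * SA) := by field_simp
    _ ≤ 1 / p * (K * (a * SB)) := by gcongr
    _ ≤ 1 / p * (K * (a * (2 / p * ((1 + 2 * L) * (B 0 + a * SH + SN))))) := by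
        gcongr
        exact h5.trans (by gcongr)
    _ = _ := by field_simp

end Recursion

/-! ### The descent lemma for smooth functions. -/

section Descent

variable {E : Type*} [NormedAddCommGroup E] [InnerProductSpace ℝ E] [CompleteSpace E]

theorem le_of_lipschitz_gradient {F : E → ℝ} {β : ℝ} (hF : Differentiable ℝ F)
    (hβ : ∀ x y, ‖gradient F x - gradient F y‖ ≤ β * ‖x - y‖) (x v : E) :
    F (x + v) ≤ F x + inner ℝ (gradient F x) v + β / 2 * ‖v‖ ^ 2 := by
  -- Monotonicity of this defect on `[0, 1]` replaces integration of the gradient along the segment.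
  let φ : ℝ → ℝ := fun s => F (x + s • v) - s * inner ℝ (gradient F x) v - β / 2 * s ^ 2 * ‖v‖ ^ 2
  have hd : ∀ s, HasDerivAt φ (inner ℝ (gradient F (x + s • v)) v - inner ℝ (gradient F x) v -
      β * s * ‖v‖ ^ 2) s := by
    intro s
    have h1 : HasDerivAt (fun s : ℝ => x + s • v) v s := by
      simpa using ((hasDerivAt_id s).smul_const v).const_add x
    have h2 : HasDerivAt (fun s : ℝ => F (x + s • v)) (inner ℝ (gradient F (x + s • v)) v) s := by
      rw [inner_gradient_left]
      exact (hF (x + s • v)).hasFDerivAt.comp_hasDerivAt s h1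
    have h3 : HasDerivAt (fun s : ℝ => s * inner ℝ (gradient F x) v) (inner ℝ (gradient F x) v) s := by
      simpa using (hasDerivAt_id s).mul_const (inner ℝ (gradient F x) v)
    have h4 : HasDerivAt (fun s : ℝ => β / 2 * s ^ 2 * ‖v‖ ^ 2) (β * s * ‖v‖ ^ 2) s := by
      have := (((hasDerivAt_id s).pow 2).const_mul (β / 2)).mul_const (‖v‖ ^ 2)
      refine this.congr_deriv ?_
      simp only [id]
      push_cast
      ring
    exact (h2.sub h3).sub h4
  have hanti : AntitoneOn φ (Set.Icc 0 1) := by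
    refine antitoneOn_of_deriv_nonpos (convex_Icc 0 1)
      (fun s _ => (hd s).continuousAt.continuousWithinAt)
      (fun s _ => (hd s).differentiableAt.differentiableWithinAt) fun s hs => ?_
    rw [interior_Icc] at hs
    rw [(hd s).deriv, ← inner_sub_left]
    have h1 := real_inner_le_norm (gradient F (x + s • v) - gradient F x) v
    have h2 := hβ (x + s • v) x
    rw [add_sub_cancel_left, norm_smul, Real.norm_of_nonneg hs.1.le] at h2
    have h3 := mul_le_mul_of_nonneg_right h2 (norm_nonneg v)
    linarith
  have h := hanti (Set.left_mem_Icc.2 zero_le_one) (Set.right_mem_Icc.2 zero_le_one) zero_le_one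
  simp only [φ, one_smul, zero_smul, add_zero] at h
  linarith

end Descent

/-! ### Deterministic analysis along one trajectory. -/

section Trajectory

variable {n d : ℕ} {s : Strategy} {G : SimpleGraph (Fin n)} {W : Matrix (Fin n) (Fin n) ℝ}
  {α β : ℝ} {θ₀ : EuclideanSpace ℝ (Fin d)} {Θ Y g : ℕ → Fin n → EuclideanSpace ℝ (Fin d)}
  {Gr : Fin n → EuclideanSpace ℝ (Fin d) → EuclideanSpace ℝ (Fin d)}

/-- `Θ`, `Y` are the iterates and trackers of gradient tracking driven by the gradient estimates
`g`. -/
structure IsTracking (W : Matrix (Fin n) (Fin n) ℝ) (α : ℝ) (θ₀ : EuclideanSpace ℝ (Fin d))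
    (Θ Y g : ℕ → Fin n → EuclideanSpace ℝ (Fin d)) : Prop where
  init_iterate : Θ 0 = fun _ => θ₀
  init_tracker : Y 0 = g 0
  step_iterate : ∀ t, Θ (t + 1) = mix W (Θ t - α • Y t)
  step_tracker : ∀ t, Y (t + 1) = mix W (Y t) + (g (t + 1) - g t)

/-- The tracking invariant: mixing keeps averages, and the gradient increments telescope from `Y 0 =
g 0`. -/
theorem IsTracking.avg_tracker (hW : IsMixingMatrix s G (fun _ => 1) W)
    (h : IsTracking W α θ₀ Θ Y g) (t : ℕ) : avg (Y t) = avg (g t) := by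
  induction t with
  | zero => rw [h.init_tracker]
  | succ t ih =>
    rw [h.step_tracker, avg_add, avg_mix hW, ih, avg_sub]
    abel

theorem IsTracking.avg_iterate (hW : IsMixingMatrix s G (fun _ => 1) W)
    (h : IsTracking W α θ₀ Θ Y g) (t : ℕ) :
    avg (Θ (t + 1)) = avg (Θ t) - α • avg (g t) := by
  rw [h.step_iterate, avg_mix hW, avg_sub, avg_smul, h.avg_tracker hW]

/-- The squared size of the gradient noise over the network. -/
def noiseSq (Gr : Fin n → EuclideanSpace ℝ (Fin d) → EuclideanSpace ℝ (Fin d))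
    (θ g : Fin n → EuclideanSpace ℝ (Fin d)) : ℝ :=
  ∑ i, ‖g i - Gr i (θ i)‖ ^ 2

theorem noiseSq_nonneg (θ g : Fin n → EuclideanSpace ℝ (Fin d)) : 0 ≤ noiseSq Gr θ g :=
  Finset.sum_nonneg fun _ _ => sq_nonneg _

theorem norm_add_add_sq_le {E : Type*} [NormedAddCommGroup E] (a b c : E) :
    ‖a + b + c‖ ^ 2 ≤ 3 * (‖a‖ ^ 2 + ‖b‖ ^ 2 + ‖c‖ ^ 2) := by
  have h : ‖a + b + c‖ ^ 2 ≤ (‖a‖ + ‖b‖ + ‖c‖) ^ 2 := by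
    gcongr
    exact norm_add₃_le
  nlinarith [sq_nonneg (‖a‖ - ‖b‖), sq_nonneg (‖a‖ - ‖c‖), sq_nonneg (‖b‖ - ‖c‖)]

theorem norm_add_sq_le_two {E : Type*} [NormedAddCommGroup E] (a b : E) :
    ‖a + b‖ ^ 2 ≤ 2 * ‖a‖ ^ 2 + 2 * ‖b‖ ^ 2 := by
  have h := norm_add_sq_le_weighted one_pos a b
  norm_num at h
  exact h

theorem norm_avg_estimate_sq_le [NeZero n] (θ g : Fin n → EuclideanSpace ℝ (Fin d)) :
    n * ‖avg g‖ ^ 2 ≤ 2 * (n * ‖avg fun i => Gr i (θ i)‖ ^ 2) + 2 * noiseSq Gr θ g := by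
  have h1 := norm_add_sq_le_two (avg fun i => Gr i (θ i)) (avg (g - fun i => Gr i (θ i)))
  rw [← avg_add, add_sub_cancel] at h1
  have h2 : n * ‖avg (g - fun i => Gr i (θ i))‖ ^ 2 ≤ noiseSq Gr θ g := norm_avg_sq_le _
  have h3 := mul_le_mul_of_nonneg_left h1 (Nat.cast_nonneg (α := ℝ) n)
  linarith

/-- A step splits into the new deviation, the old deviation and the move of the average, which is
`-α • avg (g t)`. -/
theorem IsTracking.sum_step_sq_le [NeZero n] (hW : IsMixingMatrix s G (fun _ => 1) W)
    (h : IsTracking W α θ₀ Θ Y g) (t : ℕ) :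
    ∑ i, ‖Θ (t + 1) i - Θ t i‖ ^ 2 ≤ 3 * (consensusError (Θ (t + 1)) + consensusError (Θ t) +
      α ^ 2 * (n * ‖avg (g t)‖ ^ 2)) := by
  have hi : ∀ i, ‖Θ (t + 1) i - Θ t i‖ ^ 2 ≤ 3 * (‖Θ (t + 1) i - avg (Θ (t + 1))‖ ^ 2 +
      ‖Θ t i - avg (Θ t)‖ ^ 2 + α ^ 2 * ‖avg (g t)‖ ^ 2) := by
    intro i
    have e : Θ (t + 1) i - Θ t i = (Θ (t + 1) i - avg (Θ (t + 1))) + -(Θ t i - avg (Θ t)) +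
        -(α • avg (g t)) := by
      rw [h.avg_iterate hW]
      abel
    rw [e]
    refine (norm_add_add_sq_le _ _ _).trans (le_of_eq ?_)
    rw [norm_neg, norm_neg, norm_smul, mul_pow, Real.norm_eq_abs, sq_abs]
  refine (Finset.sum_le_sum fun i _ => hi i).trans (le_of_eq ?_)
  simp only [← Finset.mul_sum, Finset.sum_add_distrib, consensusError, Finset.sum_const,
    Finset.card_univ, Fintype.card_fin, nsmul_eq_mul]

theorem sum_estimate_step_sq_le (hGr : ∀ i x y, ‖Gr i x - Gr i y‖ ≤ β * ‖x - y‖)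
    (θ θ' g g' : Fin n → EuclideanSpace ℝ (Fin d)) :
    ∑ i, ‖g' i - g i‖ ^ 2 ≤
      3 * (β ^ 2 * ∑ i, ‖θ' i - θ i‖ ^ 2 + noiseSq Gr θ' g' + noiseSq Gr θ g) := by
  simp only [noiseSq, Finset.mul_sum, ← Finset.sum_add_distrib]
  refine Finset.sum_le_sum fun i _ => ?_
  have e : g' i - g i = (Gr i (θ' i) - Gr i (θ i)) + (g' i - Gr i (θ' i)) +
      -(g i - Gr i (θ i)) := by abel
  rw [e]
  refine (norm_add_add_sq_le _ _ _).trans ?_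
  rw [norm_neg, ← mul_pow]
  gcongr
  exact hGr _ _ _

/-- The tracker is perturbed by the change of the gradient estimates, bounded through smoothness by
the displacement of the iterates plus noise at two times. The constant collects `3β²` from this
bound times `6(1 + K)` from the displacement, and `3` for the noise. -/
theorem IsTracking.tracker_error_le [NeZero n] (hW : IsMixingMatrix s G (fun _ => 1) W)
    {q K : ℝ} (hq1 : q < 1) (hK : 0 < K)
    (hc : ∀ (d : ℕ) (x y : Fin n → EuclideanSpace ℝ (Fin d)),
      consensusError (mix W x + y) ≤ q * consensusError x + K * consensusError y)
    (hα : α ^ 2 ≤ 1) (hGr : ∀ i x y, ‖Gr i x - Gr i y‖ ≤ β * ‖x - y‖)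
    (h : IsTracking W α θ₀ Θ Y g) {t : ℕ}
    (hA : consensusError (Θ (t + 1)) ≤
      q * consensusError (Θ t) + K * (α ^ 2 * consensusError (Y t))) :
    consensusError (Y (t + 1)) ≤ q * consensusError (Y t) + K * (18 * β ^ 2 * (1 + K) + 3) *
      (consensusError (Θ t) + α ^ 2 * consensusError (Y t) +
        α ^ 2 * (n * ‖avg fun i => Gr i (Θ t i)‖ ^ 2) + noiseSq Gr (Θ t) (g t) +
        noiseSq Gr (Θ (t + 1)) (g (t + 1))) := by
  have h1 : consensusError (Y (t + 1)) ≤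
      q * consensusError (Y t) + K * consensusError (g (t + 1) - g t) := by
    rw [h.step_tracker]
    exact hc _ _ _
  have h2 := (consensusError_le_sum_sq (g (t + 1) - g t)).trans
    (sum_estimate_step_sq_le hGr (Θ t) (Θ (t + 1)) (g t) (g (t + 1)))
  have h3 := h.sum_step_sq_le hW t
  have h4 := norm_avg_estimate_sq_le (Gr := Gr) (Θ t) (g t)
  have hAt := consensusError_nonneg (Θ t)
  have hBt := consensusError_nonneg (Y t)
  have hN := noiseSq_nonneg (Gr := Gr) (Θ t) (g t)
  have hN' := noiseSq_nonneg (Gr := Gr) (Θ (t + 1)) (g (t + 1))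
  have hH : 0 ≤ n * ‖avg fun i => Gr i (Θ t i)‖ ^ 2 := by positivity
  rw [mul_assoc]
  refine h1.trans (add_le_add le_rfl (mul_le_mul_of_nonneg_left (h2.trans ?_) hK.le))
  generalize consensusError (Θ t) = A at *
  generalize consensusError (Θ (t + 1)) = A' at *
  generalize consensusError (Y t) = B at *
  generalize noiseSq Gr (Θ t) (g t) = N at *
  generalize noiseSq Gr (Θ (t + 1)) (g (t + 1)) = N' at *
  generalize n * ‖avg fun i => Gr i (Θ t i)‖ ^ 2 = H at *
  generalize n * ‖avg (g t)‖ ^ 2 = R at *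
  generalize ∑ i, ‖Θ (t + 1) i - Θ t i‖ ^ 2 = S at *
  have hα0 : 0 ≤ α ^ 2 := sq_nonneg α
  have hβ0 : 0 ≤ β ^ 2 := sq_nonneg β
  generalize α ^ 2 = a at *
  generalize β ^ 2 = b at *
  have h5 : a * R ≤ 2 * (a * H) + 2 * N := by
    have e1 := mul_le_mul_of_nonneg_left h4 hα0
    have e2 := mul_le_mul_of_nonneg_right hα hN
    linarith
  have h6 : A' ≤ A + K * (a * B) := by
    have := mul_le_mul_of_nonneg_right hq1.le hAt
    linarith
  have h7 : S ≤ 6 * (1 + K) * (A + a * B + a * H + N) := by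
    have e1 : 0 ≤ a * B := by positivity
    have e2 : 0 ≤ a * H := by positivity
    have e3 : 0 ≤ K * A := by positivity
    have e4 : 0 ≤ K * (a * B) := by positivity
    have e5 : 0 ≤ K * (a * H) := by positivity
    have e6 : 0 ≤ K * N := by positivity
    linarith
  have h8 := mul_le_mul_of_nonneg_left h7 hβ0
  have e1 : 0 ≤ a * B := by positivity
  have e2 : 0 ≤ a * H := by positivity
  have e3 : 0 ≤ b * (1 + K) * N' := by positivity
  linarith

/-- The accumulated consensus error of gradient tracking is of order `α ^ 2`. -/
theorem exists_sum_consensusError_le (hG : G.Connected)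
    (hW : IsMixingMatrix s G (fun _ => 1) W) (β : ℝ) :
    ∃ M a : ℝ, 0 < M ∧ 0 < a ∧ ∀ (d : ℕ) (α : ℝ) (θ₀ : EuclideanSpace ℝ (Fin d))
      (Θ Y g : ℕ → Fin n → EuclideanSpace ℝ (Fin d))
      (Gr : Fin n → EuclideanSpace ℝ (Fin d) → EuclideanSpace ℝ (Fin d)),
      α ^ 2 ≤ a → (∀ i x y, ‖Gr i x - Gr i y‖ ≤ β * ‖x - y‖) → IsTracking W α θ₀ Θ Y g →
      ∀ T : ℕ, ∑ t ∈ Finset.range T, consensusError (Θ t) ≤ M * α ^ 2 *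
        (consensusError (g 0) +
          α ^ 2 * ∑ t ∈ Finset.range T, n * ‖avg fun i => Gr i (Θ t i)‖ ^ 2 +
          ∑ t ∈ Finset.range (T + 1), noiseSq Gr (Θ t) (g t)) := by
  obtain ⟨q, K, hq0, hq1, hK, hc⟩ := exists_consensusError_mix_add_le hG hW
  have : NeZero n := ⟨by
    obtain ⟨i⟩ := hG.nonempty
    exact i.pos.ne'⟩
  have hL : 0 < K * (18 * β ^ 2 * (1 + K) + 3) := by positivity
  set L := K * (18 * β ^ 2 * (1 + K) + 3)
  have hp : 0 < 1 - q := by linarith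
  have hden : 0 < L * K + (1 - q) * L := by positivity
  refine ⟨2 * K * (1 + 2 * L) / (1 - q) ^ 2,
    min 1 ((1 - q) ^ 2 / 2 / (L * K + (1 - q) * L)), by positivity, by positivity, ?_⟩
  intro d α θ₀ Θ Y g Gr hα hGr h T
  have hArec : ∀ t, consensusError (Θ (t + 1)) ≤
      q * consensusError (Θ t) + K * (α ^ 2 * consensusError (Y t)) := by
    intro t
    have e : Θ (t + 1) = mix W (Θ t) + (-α) • mix W (Y t) := by
      rw [h.step_iterate, ← mix_smul, ← mix_add, neg_smul, sub_eq_add_neg]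
    have h1 := hc _ (Θ t) ((-α) • mix W (Y t))
    -- Taking zero perturbation in `hc` shows that mixing is nonexpansive.
    have h2 : consensusError (mix W (Y t)) ≤ consensusError (Y t) := by
      have := hc _ (Y t) 0
      have hz : consensusError (0 : Fin n → EuclideanSpace ℝ (Fin d)) = 0 := by
        simp [consensusError, avg]
      rw [hz, add_zero, mul_zero, add_zero] at this
      exact this.trans (mul_le_of_le_one_left (consensusError_nonneg _) hq1.le)
    rw [← e, consensusError_smul, neg_sq] at h1
    refine h1.trans ?_
    gcongr
  have hres := sum_le_of_coupled hq1 hK hL (sq_nonneg α)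
    ((le_div_iff₀ hden).1 (hα.trans (min_le_right _ _)))
    (A := fun t => consensusError (Θ t)) (B := fun t => consensusError (Y t))
    (H := fun t => n * ‖avg fun i => Gr i (Θ t i)‖ ^ 2) (N := fun t => noiseSq Gr (Θ t) (g t))
    (fun t => consensusError_nonneg _) (fun t => consensusError_nonneg _)
    (fun t => by positivity) (fun t => noiseSq_nonneg _ _)
    (by simp [h.init_iterate, consensusError, avg_const]) hArec
    (fun t => h.tracker_error_le hW hq1 hK hc (hα.trans (min_le_left _ _)) hGr (hArec t)) T
  rwa [h.init_tracker] at hres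

/-- This is the price of evaluating local gradients at separate points, and the only place where
consensus enters the descent. -/
theorem norm_avg_gradient_sub_sq_le [NeZero n]
    (hGr : ∀ i x y, ‖Gr i x - Gr i y‖ ≤ β * ‖x - y‖) (θ : Fin n → EuclideanSpace ℝ (Fin d)) :
    n * ‖(avg fun i => Gr i (avg θ)) - avg fun i => Gr i (θ i)‖ ^ 2 ≤
      β ^ 2 * consensusError θ := by
  have h := norm_avg_sq_le ((fun i => Gr i (avg θ)) - fun i => Gr i (θ i))
  rw [avg_sub] at h
  refine h.trans ?_
  rw [consensusError, Finset.mul_sum]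
  refine Finset.sum_le_sum fun i _ => ?_
  rw [← mul_pow, Pi.sub_apply, ← norm_neg (θ i - avg θ), neg_sub]
  gcongr
  exact hGr _ _ _

theorem consensusError_estimate_le [NeZero n] (θ g : Fin n → EuclideanSpace ℝ (Fin d))
    (c : EuclideanSpace ℝ (Fin d)) :
    consensusError g ≤ 2 * ∑ i, ‖Gr i (θ i) - c‖ ^ 2 + 2 * noiseSq Gr θ g := by
  refine (consensusError_le_sum_sq_sub g c).trans ?_
  rw [noiseSq, Finset.mul_sum, Finset.mul_sum, ← Finset.sum_add_distrib]
  refine Finset.sum_le_sum fun i _ => ?_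
  have e : g i - c = (Gr i (θ i) - c) + (g i - Gr i (θ i)) := by abel
  rw [e]
  exact norm_add_sq_le_two _ _

/-- The descent inequality along the averaged trajectory. -/
theorem IsTracking.descent [NeZero n] (hW : IsMixingMatrix s G (fun _ => 1) W)
    (hα : 0 < α) {F : EuclideanSpace ℝ (Fin d) → ℝ} {Δ : ℝ} (hF : Differentiable ℝ F)
    (hβ : ∀ x y, ‖gradient F x - gradient F y‖ ≤ β * ‖x - y‖)
    (hGr : ∀ i x y, ‖Gr i x - Gr i y‖ ≤ β * ‖x - y‖)
    (hFG : ∀ x, gradient F x = avg fun i => Gr i x) (hΔ : ∀ x, F θ₀ - F x ≤ Δ)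
    (h : IsTracking W α θ₀ Θ Y g) (T : ℕ) :
    ∑ t ∈ Finset.range T, ‖gradient F (avg (Θ t))‖ ^ 2 ≤ 2 * Δ / α +
      ∑ t ∈ Finset.range T, (-(1 - β * α) * ‖avg fun i => Gr i (Θ t i)‖ ^ 2 +
        β ^ 2 / n * consensusError (Θ t) +
        β * α * ‖avg fun i => g t i - Gr i (Θ t i)‖ ^ 2 -
        inner ℝ ((2 : ℝ) • gradient F (avg (Θ t)) - (2 * β * α) • avg fun i => Gr i (Θ t i))
          (avg fun i => g t i - Gr i (Θ t i))) := by
  have hn : (0 : ℝ) < n := by exact_mod_cast NeZero.pos n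
  have hstep : ∀ t, ‖gradient F (avg (Θ t))‖ ^ 2 ≤
      2 / α * (F (avg (Θ t)) - F (avg (Θ (t + 1)))) +
      (-(1 - β * α) * ‖avg fun i => Gr i (Θ t i)‖ ^ 2 +
        β ^ 2 / n * consensusError (Θ t) +
        β * α * ‖avg fun i => g t i - Gr i (Θ t i)‖ ^ 2 -
        inner ℝ ((2 : ℝ) • gradient F (avg (Θ t)) - (2 * β * α) • avg fun i => Gr i (Θ t i))
          (avg fun i => g t i - Gr i (Θ t i))) := by
    intro t
    have hd := le_of_lipschitz_gradient hF hβ (avg (Θ t)) (-(α • avg (g t)))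
    rw [← sub_eq_add_neg, ← h.avg_iterate hW] at hd
    have hg : avg (g t) = (avg fun i => Gr i (Θ t i)) + avg fun i => g t i - Gr i (Θ t i) := by
      rw [← avg_add]
      congr 1
      funext i
      simp
    have hc := norm_avg_gradient_sub_sq_le hGr (Θ t)
    rw [← hFG] at hc
    have hc' : ‖gradient F (avg (Θ t)) - avg fun i => Gr i (Θ t i)‖ ^ 2 ≤
        β ^ 2 / n * consensusError (Θ t) := by
      rw [div_mul_eq_mul_div, le_div_iff₀ hn, mul_comm]
      exact hc
    rw [hg] at hd
    generalize (avg fun i => Gr i (Θ t i)) = u at *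
    generalize (avg fun i => g t i - Gr i (Θ t i)) = e at *
    generalize gradient F (avg (Θ t)) = v at *
    rw [norm_neg, norm_smul, mul_pow, Real.norm_eq_abs, sq_abs, norm_add_sq_real, inner_neg_right,
      inner_smul_right, inner_add_right] at hd
    -- Polarization: `-2⟨v, u⟩ = ‖v - u‖² - ‖v‖² - ‖u‖²`, with `‖v - u‖²` bounded by the consensus
    -- error. Terms linear in `e` are kept exactly so that they can vanish in expectation.
    rw [norm_sub_sq_real] at hc'
    rw [inner_sub_left, inner_smul_left, inner_smul_left]
    simp only [conj_trivial]
    have hdα := mul_le_mul_of_nonneg_left hd (by positivity : 0 ≤ 2 / α)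
    have e1 : 2 / α * (F (avg (Θ t)) + -(α * (inner ℝ v u + inner ℝ v e)) +
        β / 2 * (α ^ 2 * (‖u‖ ^ 2 + 2 * inner ℝ u e + ‖e‖ ^ 2))) =
        2 / α * F (avg (Θ t)) - 2 * (inner ℝ v u + inner ℝ v e) +
        β * α * (‖u‖ ^ 2 + 2 * inner ℝ u e + ‖e‖ ^ 2) := by
      field_simp
      ring
    rw [e1] at hdα
    linarith
  refine (Finset.sum_le_sum fun t _ => hstep t).trans ?_
  rw [Finset.sum_add_distrib, ← Finset.mul_sum, Finset.sum_range_sub']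
  refine add_le_add ?_ le_rfl
  rw [h.init_iterate, avg_const, div_mul_eq_mul_div]
  gcongr
  exact hΔ _

/-- The pathwise bound on the squared gradients along the averaged trajectory. -/
theorem exists_sum_gradient_sq_le (hG : G.Connected)
    (hW : IsMixingMatrix s G (fun _ => 1) W) (hβ : 0 < β) :
    ∃ M a : ℝ, 0 < M ∧ 0 < a ∧ ∀ (d : ℕ) (α Δ : ℝ) (θ₀ : EuclideanSpace ℝ (Fin d))
      (Θ Y g : ℕ → Fin n → EuclideanSpace ℝ (Fin d))
      (Gr : Fin n → EuclideanSpace ℝ (Fin d) → EuclideanSpace ℝ (Fin d))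
      (F : EuclideanSpace ℝ (Fin d) → ℝ),
      0 < α → α ^ 2 ≤ a → Differentiable ℝ F →
      (∀ x y, ‖gradient F x - gradient F y‖ ≤ β * ‖x - y‖) →
      (∀ i x y, ‖Gr i x - Gr i y‖ ≤ β * ‖x - y‖) →
      (∀ x, gradient F x = avg fun i => Gr i x) → (∀ x, F θ₀ - F x ≤ Δ) →
      IsTracking W α θ₀ Θ Y g →
      ∀ T : ℕ, ∑ t ∈ Finset.range T, ‖gradient F (avg (Θ t))‖ ^ 2 ≤ 2 * Δ / α +
        M * α ^ 2 * (∑ i, ‖Gr i θ₀ - gradient F θ₀‖ ^ 2 + noiseSq Gr (Θ 0) (g 0) +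
          ∑ t ∈ Finset.range (T + 1), noiseSq Gr (Θ t) (g t)) +
        β * α * ∑ t ∈ Finset.range T, ‖avg fun i => g t i - Gr i (Θ t i)‖ ^ 2 -
        ∑ t ∈ Finset.range T, inner ℝ
          ((2 : ℝ) • gradient F (avg (Θ t)) - (2 * β * α) • avg fun i => Gr i (Θ t i))
          (avg fun i => g t i - Gr i (Θ t i)) := by
  obtain ⟨M, a, hM, ha, hc⟩ := exists_sum_consensusError_le hG hW β
  have : NeZero n := ⟨by
    obtain ⟨i⟩ := hG.nonempty
    exact i.pos.ne'⟩
  have hn : (0 : ℝ) < n := by exact_mod_cast NeZero.pos n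
  -- The caps yield `α ≤ 1`, `β * α ≤ 1 / 2` and `β ^ 2 * M * α ^ 4 ≤ 1 / 2`. The last two let `-(1
  -- - β * α) * SH` absorb the averaged gradients fed back by the consensus bound.
  refine ⟨2 * (β ^ 2 / n * M), min a (min 1 (min (1 / (2 * β)) (1 / (2 * (β ^ 2 * M))) ^ 2)),
    by positivity, by positivity, ?_⟩
  intro d α Δ θ₀ Θ Y g Gr F hα hαa hF hFβ hGr hFG hΔ h T
  have h1 := h.descent hW hα hF hFβ hGr hFG hΔ T
  have h2 := hc d α θ₀ Θ Y g Gr (hαa.trans (min_le_left _ _)) hGr h T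
  have h3 := consensusError_estimate_le (Gr := Gr) (Θ 0) (g 0) (gradient F θ₀)
  rw [h.init_iterate] at h3 ⊢
  have hα1 : α ≤ 1 := by
    have := hαa.trans ((min_le_right _ _).trans (min_le_left _ _))
    nlinarith
  have hα2 : α ≤ min (1 / (2 * β)) (1 / (2 * (β ^ 2 * M))) :=
    le_of_sq_le_sq (hαa.trans ((min_le_right _ _).trans (min_le_right _ _))) (by positivity)
  have hαβ : β * α ≤ 1 / 2 := by
    have := hα2.trans (min_le_left _ _)
    rw [le_div_iff₀ (by positivity)] at this
    linarith
  have hαM : β ^ 2 * M * α ^ 4 ≤ 1 / 2 := by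
    have := hα2.trans (min_le_right _ _)
    rw [le_div_iff₀ (by positivity)] at this
    have h4 : α ^ 4 ≤ α := pow_le_of_le_one hα.le hα1 (by norm_num)
    have h5 := mul_le_mul_of_nonneg_left h4 (by positivity : 0 ≤ β ^ 2 * M)
    linarith
  simp only [Finset.sum_sub_distrib, Finset.sum_add_distrib, ← Finset.mul_sum] at h1 h2
  have hN : 0 ≤ ∑ t ∈ Finset.range (T + 1), noiseSq Gr (Θ t) (g t) :=
    Finset.sum_nonneg fun _ _ => noiseSq_nonneg _ _
  have hH : 0 ≤ ∑ t ∈ Finset.range T, ‖avg fun i => Gr i (Θ t i)‖ ^ 2 :=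
    Finset.sum_nonneg fun _ _ => sq_nonneg _
  generalize ∑ t ∈ Finset.range (T + 1), noiseSq Gr (Θ t) (g t) = SN at *
  generalize ∑ t ∈ Finset.range T, ‖avg fun i => Gr i (Θ t i)‖ ^ 2 = SH at *
  have h6 : β ^ 2 / n * ∑ t ∈ Finset.range T, consensusError (Θ t) ≤ β ^ 2 / n * (M * α ^ 2 *
      (2 * ∑ i, ‖Gr i θ₀ - gradient F θ₀‖ ^ 2 + 2 * noiseSq Gr (fun _ => θ₀) (g 0) +
        α ^ 2 * (n * SH) + SN)) := by
    gcongr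
    refine h2.trans ?_
    gcongr
  have h7 : β ^ 2 / n * (M * α ^ 2 * (α ^ 2 * (n * SH))) ≤ 1 / 2 * SH := by
    have : β ^ 2 / n * (M * α ^ 2 * (α ^ 2 * (n * SH))) = β ^ 2 * M * α ^ 4 * SH := by
      field_simp
    rw [this]
    gcongr
  have h8 := mul_le_mul_of_nonneg_right hαβ hH
  have h9 : 0 ≤ β ^ 2 / n * (M * α ^ 2 * SN) := by positivity
  linarith

end Trajectory

/-! ### Noise evaluated at an independent random point. -/

section IndependentNoise

variable {Ω Ξ U : Type*} [MeasurableSpace Ω] [MeasurableSpace Ξ] [MeasurableSpace U]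
  {P : Measure Ω} [IsProbabilityMeasure P] {D : Measure Ξ} {u : Ω → U} {ξ : Ω → Ξ}

theorem map_prodMk_eq (hu : Measurable u) (hξ : Measurable ξ) (hlaw : P.map ξ = D)
    (hind : IndepFun u ξ P) : P.map (fun ω => (u ω, ξ ω)) = (P.map u).prod D := by
  rw [← hlaw]
  exact (indepFun_iff_map_prod_eq_prod_map_map hu.aemeasurable hξ.aemeasurable).1 hind

variable {E : Type*} [NormedAddCommGroup E] [InnerProductSpace ℝ E] [FiniteDimensional ℝ E] [MeasurableSpace E]
  [BorelSpace E] [IsProbabilityMeasure D] {Z : U × Ξ → E}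

/-- A noise whose conditional second moment is at most `v`, evaluated at an independent point. -/
theorem noise_secondMoment (hu : Measurable u) (hξ : Measurable ξ) (hlaw : P.map ξ = D)
    (hind : IndepFun u ξ P) (hZ : Measurable Z) {v : ℝ}
    (hint : ∀ w, Integrable (fun x => ‖Z (w, x)‖ ^ 2) D)
    (hv : ∀ w, ∫ x, ‖Z (w, x)‖ ^ 2 ∂D ≤ v) :
    MemLp (fun ω => Z (u ω, ξ ω)) 2 P ∧ ∫ ω, ‖Z (u ω, ξ ω)‖ ^ 2 ∂P ≤ v := by
  have : IsProbabilityMeasure (P.map u) := Measure.isProbabilityMeasure_map hu.aemeasurable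
  have hmeas : Measurable fun ω => Z (u ω, ξ ω) := hZ.comp (hu.prodMk hξ)
  have hZ2 : Measurable fun p => ENNReal.ofReal (‖Z p‖ ^ 2) := (hZ.norm.pow_const 2).ennreal_ofReal
  -- Tonelli comes first, because joint integrability is a conclusion here.
  have hl : ∫⁻ ω, ENNReal.ofReal (‖Z (u ω, ξ ω)‖ ^ 2) ∂P ≤ ENNReal.ofReal v := by
    calc ∫⁻ ω, ENNReal.ofReal (‖Z (u ω, ξ ω)‖ ^ 2) ∂P
        = ∫⁻ p, ENNReal.ofReal (‖Z p‖ ^ 2) ∂(P.map fun ω => (u ω, ξ ω)) :=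
          (lintegral_map hZ2 (hu.prodMk hξ)).symm
      _ = ∫⁻ w, ∫⁻ x, ENNReal.ofReal (‖Z (w, x)‖ ^ 2) ∂D ∂(P.map u) := by
          rw [map_prodMk_eq hu hξ hlaw hind, lintegral_prod _ hZ2.aemeasurable]
      _ ≤ ∫⁻ _, ENNReal.ofReal v ∂(P.map u) := by
          refine lintegral_mono fun w => ?_
          rw [← ofReal_integral_eq_lintegral_ofReal (hint w)
            (Filter.Eventually.of_forall fun _ => sq_nonneg _)]
          exact ENNReal.ofReal_le_ofReal (hv w)
      _ = _ := by simp
  have hI : Integrable (fun ω => ‖Z (u ω, ξ ω)‖ ^ 2) P := by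
    refine ⟨(hmeas.norm.pow_const 2).aestronglyMeasurable, ?_⟩
    rw [hasFiniteIntegral_iff_ofReal (Filter.Eventually.of_forall fun _ => sq_nonneg _)]
    exact hl.trans_lt ENNReal.ofReal_lt_top
  refine ⟨(memLp_two_iff_integrable_sq_norm hmeas.aestronglyMeasurable).2 hI, ?_⟩
  have hv0 : 0 ≤ v := by
    obtain ⟨ω⟩ := nonempty_of_isProbabilityMeasure P
    exact (integral_nonneg fun _ => sq_nonneg _).trans (hv (u ω))
  rw [← ENNReal.ofReal_le_ofReal_iff hv0, ofReal_integral_eq_lintegral_ofReal hI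
    (Filter.Eventually.of_forall fun _ => sq_nonneg _)]
  exact hl

/-- A conditionally centred noise is orthogonal to what it is independent of. -/
theorem integral_inner_noise_eq_zero (hu : Measurable u) (hξ : Measurable ξ)
    (hlaw : P.map ξ = D) (hind : IndepFun u ξ P) (hZ : Measurable Z)
    (hint : ∀ w, Integrable (fun x => Z (w, x)) D) (hz : ∀ w, ∫ x, Z (w, x) ∂D = 0)
    {χ : U → E} (hχ : Measurable χ) :
    ∫ ω, inner ℝ (χ (u ω)) (Z (u ω, ξ ω)) ∂P = 0 := by
  have : IsProbabilityMeasure (P.map u) := Measure.isProbabilityMeasure_map hu.aemeasurable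
  have hm : Measurable fun p : U × Ξ => (inner ℝ (χ p.1) (Z p) : ℝ) :=
    (hχ.comp measurable_fst).inner hZ
  rw [← integral_map (φ := fun ω => (u ω, ξ ω)) (f := fun p : U × Ξ => (inner ℝ (χ p.1) (Z p) : ℝ))
    (hu.prodMk hξ).aemeasurable hm.aestronglyMeasurable, map_prodMk_eq hu hξ hlaw hind]
  -- Without integrability the Bochner integral is zero by convention, so no moment condition on `χ`
  -- is needed.
  by_cases hI : Integrable (fun p : U × Ξ => (inner ℝ (χ p.1) (Z p) : ℝ)) ((P.map u).prod D)
  · rw [integral_prod _ hI]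
    simp only [integral_inner (hint _), hz, inner_zero_right, integral_zero]
  · exact integral_undef hI

end IndependentNoise

/-! ### Measurability of the states and independence of the samples. -/

section Sampling

variable {n d : ℕ} {Ω Ξ : Type*} [MeasurableSpace Ξ]
  {f : Fin n → EuclideanSpace ℝ (Fin d) → Ξ → ℝ} {W : Matrix (Fin n) (Fin n) ℝ}
  {γ : Fin n → ℝ} {α : ℝ} {θ₀ : EuclideanSpace ℝ (Fin d)}

/-- The off-by-one is the point: the iterate at time `t` involves samples strictly before `t`, the
tracker also those at `t`. The σ-algebra on `Ω` is arbitrary so that `otherSamples` can be inserted.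
-/
theorem measurable_gtState [MeasurableSpace Ω] {ξ : ℕ → Fin n → Ω → Ξ}
    (hf : ∀ i, Measurable (fun p : EuclideanSpace ℝ (Fin d) × Ξ => stochGrad f i p.1 p.2))
    (t : ℕ) :
    ((∀ k < t, ∀ j, Measurable (ξ k j)) → ∀ i,
      Measurable fun ω => (gtState W γ α f θ₀ (fun k i => ξ k i ω) t).1 i) ∧
    ((∀ k ≤ t, ∀ j, Measurable (ξ k j)) → ∀ i,
      Measurable fun ω => (gtState W γ α f θ₀ (fun k i => ξ k i ω) t).2 i) := by
  have hg : ∀ (i : Fin n) (θ : Ω → EuclideanSpace ℝ (Fin d)) (x : Ω → Ξ), Measurable θ →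
      Measurable x → Measurable fun ω => stochGrad f i (θ ω) (x ω) := fun i θ x hθ hx =>
    (hf i).comp (hθ.prodMk hx)
  induction t with
  | zero =>
    refine ⟨fun _ i => measurable_const, fun h i => ?_⟩
    exact (hg i _ _ measurable_const (h 0 le_rfl i)).const_smul (γ i)
  | succ t ih =>
    have h1 : (∀ k < t + 1, ∀ j, Measurable (ξ k j)) → ∀ i,
        Measurable fun ω => (gtState W γ α f θ₀ (fun k i => ξ k i ω) (t + 1)).1 i := by
      intro h i
      have hΘ := ih.1 fun k hk => h k (hk.trans (Nat.lt_succ_self t))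
      have hY := ih.2 fun k hk => h k (Nat.lt_succ_of_le hk)
      simp only [gtState]
      exact Finset.measurable_sum _ fun j _ => ((hΘ j).sub ((hY j).const_smul α)).const_smul (W i j)
    refine ⟨h1, fun h i => ?_⟩
    have h2 := h1 fun k hk => h k hk.le
    have hΘ := ih.1 fun k hk => h k (hk.le.trans (Nat.le_succ t))
    have hY := ih.2 fun k hk => h k (hk.trans (Nat.le_succ t))
    exact (Finset.measurable_sum _ fun j _ => (hY j).const_smul (W i j)).add
      (((hg i _ _ (h2 i) (h (t + 1) le_rfl i)).sub
        (hg i _ _ (hΘ i) (h t (Nat.le_succ t) i))).const_smul (γ i))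

/-- The information carried by all samples but the one of node `i` at iteration `t`. -/
@[reducible]
def otherSamples (ξ : ℕ → Fin n → Ω → Ξ) (t : ℕ) (i : Fin n) : MeasurableSpace Ω :=
  ⨆ p ∈ ({(t, i)}ᶜ : Set (ℕ × Fin n)), MeasurableSpace.comap (ξ p.1 p.2) inferInstance

theorem measurable_otherSamples (ξ : ℕ → Fin n → Ω → Ξ) {t k : ℕ} {i j : Fin n}
    (h : (k, j) ≠ (t, i)) : Measurable[otherSamples ξ t i] (ξ k j) := by
  refine Measurable.mono (comap_measurable (ξ k j)) ?_ le_rfl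
  exact le_iSup₂_of_le (f := fun (p : ℕ × Fin n) (_ : p ∈ ({(t, i)}ᶜ : Set (ℕ × Fin n))) =>
    MeasurableSpace.comap (ξ p.1 p.2) inferInstance) (k, j) h le_rfl

variable [mΩ : MeasurableSpace Ω] {P : Measure Ω} {D : Fin n → Measure Ξ}
  {ξ : ℕ → Fin n → Ω → Ξ}

theorem IsSampling.otherSamples_le (hξ : IsSampling P D ξ) (t : ℕ) (i : Fin n) :
    otherSamples ξ t i ≤ mΩ :=
  iSup₂_le fun p _ => (hξ.measurable p.1 p.2).comap_le

theorem IsSampling.indepFun_of_otherSamples (hξ : IsSampling P D ξ) {t : ℕ} {i : Fin n}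
    {U : Type*} [MeasurableSpace U] {u : Ω → U} (hu : Measurable[otherSamples ξ t i] u) :
    IndepFun u (ξ t i) P := by
  have h := indep_iSup_of_disjoint (fun p : ℕ × Fin n => (hξ.measurable p.1 p.2).comap_le)
    hξ.indep (S := {(t, i)}ᶜ) (T := {(t, i)}) disjoint_compl_left
  rw [IndepFun_iff_Indep]
  refine indep_of_indep_of_le_left (indep_of_indep_of_le_right h ?_) hu.comap_le
  exact le_iSup₂_of_le (f := fun (p : ℕ × Fin n) (_ : p ∈ ({(t, i)} : Set (ℕ × Fin n))) =>
    MeasurableSpace.comap (ξ p.1 p.2) inferInstance) (t, i) rfl le_rfl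

end Sampling

/-! ### Square-integrable vectors and averages of orthogonal noises. -/

section SquareIntegrable

variable {Ω E : Type*} [MeasurableSpace Ω] {P : Measure Ω} [NormedAddCommGroup E]

theorem memLp_comp_of_lipschitz [IsFiniteMeasure P] {g : E → E} {β : ℝ} (hg : ∀ x y, ‖g x - g y‖ ≤ β * ‖x - y‖) {u : Ω → E} (hu : MemLp u 2 P) :
    MemLp (fun ω => g (u ω)) 2 P := by
  -- Subtracting `g 0` makes the map vanish at zero; the constant is restored using finiteness of
  -- `P`.
  have hl : LipschitzWith β.toNNReal (fun x => g x - g 0) :=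
    LipschitzWith.of_dist_le' fun x y => by
      simpa [dist_eq_norm] using hg x y
  have h := (hl.comp_memLp (by simp) hu).add (memLp_const (g 0))
  refine h.ae_eq (Filter.Eventually.of_forall fun ω => ?_)
  simp

variable [InnerProductSpace ℝ E]

theorem integrable_inner_of_memLp {u v : Ω → E} (hu : MemLp u 2 P) (hv : MemLp v 2 P) :
    Integrable (fun ω => (inner ℝ (u ω) (v ω) : ℝ)) P := by
  have hu2 := (memLp_two_iff_integrable_sq_norm hu.1).1 hu
  have hv2 := (memLp_two_iff_integrable_sq_norm hv.1).1 hv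
  refine (hu2.add hv2).mono' (hu.1.inner hv.1) (Filter.Eventually.of_forall fun ω => ?_)
  have h1 := norm_inner_le_norm (𝕜 := ℝ) (u ω) (v ω)
  rw [Pi.add_apply]
  nlinarith [sq_nonneg (‖u ω‖ - ‖v ω‖), sq_nonneg ‖u ω‖, sq_nonneg ‖v ω‖]

theorem memLp_avg {n : ℕ} {x : Fin n → Ω → E} (hx : ∀ i, MemLp (x i) 2 P) :
    MemLp (fun ω => avg fun i => x i ω) 2 P :=
  (memLp_finsetSum Finset.univ fun i _ => hx i).const_smul (1 / (n : ℝ))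

/-- Only the `n` diagonal terms survive against the factor `1 / n ^ 2`; this is the source of the
speedup in `n`. -/
theorem integral_norm_avg_sq_le {n : ℕ} [NeZero n] {x : Fin n → Ω → E} {v : ℝ}
    (hx : ∀ i, MemLp (x i) 2 P) (hv : ∀ i, ∫ ω, ‖x i ω‖ ^ 2 ∂P ≤ v)
    (horth : ∀ i j, i ≠ j → ∫ ω, inner ℝ (x i ω) (x j ω) ∂P = 0) :
    ∫ ω, ‖avg fun i => x i ω‖ ^ 2 ∂P ≤ v / n := by
  have hn : (0 : ℝ) < n := by exact_mod_cast NeZero.pos n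
  have e : ∀ ω, ‖avg fun i => x i ω‖ ^ 2 =
      (1 / (n : ℝ)) ^ 2 * ∑ i, ∑ j, inner ℝ (x i ω) (x j ω) := by
    intro ω
    rw [avg, norm_smul, mul_pow, Real.norm_eq_abs, sq_abs, ← real_inner_self_eq_norm_sq, sum_inner]
    simp only [inner_sum]
  have hI : ∀ i j, Integrable (fun ω => (inner ℝ (x i ω) (x j ω) : ℝ)) P := fun i j =>
    integrable_inner_of_memLp (hx i) (hx j)
  simp only [e]
  rw [integral_const_mul, integral_finsetSum _ fun i _ => integrable_finsetSum _ fun j _ => hI i j]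
  have h1 : ∀ i, ∫ ω, ∑ j, inner ℝ (x i ω) (x j ω) ∂P ≤ v := by
    intro i
    rw [integral_finsetSum _ fun j _ => hI i j,
      Finset.sum_eq_single i (fun j _ hj => horth i j hj.symm) (by simp)]
    simpa only [real_inner_self_eq_norm_sq] using hv i
  calc (1 / (n : ℝ)) ^ 2 * ∑ i, ∫ ω, ∑ j, inner ℝ (x i ω) (x j ω) ∂P
      ≤ (1 / (n : ℝ)) ^ 2 * ∑ _i : Fin n, v := by
        gcongr
        exact h1 _
    _ = v / n := by
        simp
        field_simp

theorem integral_inner_avg_eq_zero {n : ℕ} {X : Ω → E} {x : Fin n → Ω → E} (hX : MemLp X 2 P)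
    (hx : ∀ i, MemLp (x i) 2 P) (horth : ∀ i, ∫ ω, inner ℝ (X ω) (x i ω) ∂P = 0) :
    ∫ ω, inner ℝ (X ω) (avg fun i => x i ω) ∂P = 0 := by
  simp only [avg, inner_smul_right, inner_sum]
  rw [integral_const_mul,
    integral_finsetSum _ fun i _ => integrable_inner_of_memLp hX (hx i)]
  simp [horth]

end SquareIntegrable

/-! ### Gradients of the losses and their noise. -/

section Gradients

variable {n d : ℕ} {Ξ : Type*} [MeasurableSpace Ξ] {D : Fin n → Measure Ξ}
  {f : Fin n → EuclideanSpace ℝ (Fin d) → Ξ → ℝ} {β : ℝ}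

theorem IsSmoothFamily.continuous_gradient (hs : IsSmoothFamily β D f) (i : Fin n) :
    Continuous (gradient (localLoss D f i)) :=
  (LipschitzWith.of_dist_le' (K := β) fun x y => by
    simpa [dist_eq_norm] using hs.lipschitz i x y).continuous

theorem IsSmoothFamily.hasGradientAt_globalLoss (hs : IsSmoothFamily β D f)
    (θ : EuclideanSpace ℝ (Fin d)) :
    HasGradientAt (globalLoss (fun _ => 1) D f) (avg fun i => gradient (localLoss D f i) θ) θ := by
  have h : HasFDerivAt (fun θ => 1 / (n : ℝ) * ∑ i, localLoss D f i θ)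
      ((1 / (n : ℝ)) • ∑ i, InnerProductSpace.toDual ℝ _ (gradient (localLoss D f i) θ)) θ :=
    (HasFDerivAt.fun_sum fun i _ => (hs.differentiable i θ).hasGradientAt.hasFDerivAt).const_mul _
  rw [hasGradientAt_iff_hasFDerivAt, avg, map_smul, map_sum]
  refine h.congr_of_eventuallyEq (Filter.Eventually.of_forall fun θ => ?_)
  simp [globalLoss]

theorem IsSmoothFamily.gradient_globalLoss (hs : IsSmoothFamily β D f)
    (θ : EuclideanSpace ℝ (Fin d)) :
    gradient (globalLoss (fun _ => 1) D f) θ = avg fun i => gradient (localLoss D f i) θ :=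
  (hs.hasGradientAt_globalLoss θ).gradient

theorem IsSmoothFamily.lipschitz_globalLoss [NeZero n] (hs : IsSmoothFamily β D f)
    (x y : EuclideanSpace ℝ (Fin d)) :
    ‖gradient (globalLoss (fun _ => 1) D f) x - gradient (globalLoss (fun _ => 1) D f) y‖ ≤
      β * ‖x - y‖ := by
  have hn : (0 : ℝ) < n := by exact_mod_cast NeZero.pos n
  rw [hs.gradient_globalLoss, hs.gradient_globalLoss, ← avg_sub, avg, norm_smul,
    Real.norm_of_nonneg (by positivity)]
  calc 1 / (n : ℝ) * ‖∑ i, ((fun i => gradient (localLoss D f i) x) -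
        fun i => gradient (localLoss D f i) y) i‖
      ≤ 1 / (n : ℝ) * ∑ _i : Fin n, β * ‖x - y‖ := by
        gcongr
        exact norm_sum_le_of_le _ fun i _ => hs.lipschitz i x y
    _ = _ := by
        simp
        field_simp

/-- The noise of the stochastic gradients. -/
def gradNoise (D : Fin n → Measure Ξ) (f : Fin n → EuclideanSpace ℝ (Fin d) → Ξ → ℝ) (i : Fin n)
    (p : EuclideanSpace ℝ (Fin d) × Ξ) : EuclideanSpace ℝ (Fin d) :=
  stochGrad f i p.1 p.2 - gradient (localLoss D f i) p.1

theorem measurable_gradNoise (hl : IsLossFamily D f) (hs : IsSmoothFamily β D f)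
    (i : Fin n) : Measurable (gradNoise D f i) :=
  (hl.measurable_grad i).sub ((hs.continuous_gradient i).measurable.comp measurable_fst)

variable {υ : ℝ} [∀ i, IsProbabilityMeasure (D i)]

theorem integrable_gradNoise (hl : IsLossFamily D f) (hs : IsSmoothFamily β D f)
    (ho : IsOracle υ D f) (i : Fin n) (θ : EuclideanSpace ℝ (Fin d)) :
    Integrable (fun x => gradNoise D f i (θ, x)) (D i) := by
  have hm : Measurable fun x => gradNoise D f i (θ, x) :=
    (measurable_gradNoise hl hs i).comp measurable_prodMk_left
  exact ((memLp_two_iff_integrable_sq_norm hm.aestronglyMeasurable).2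
    (ho.integrable_sq i θ)).integrable one_le_two

theorem integral_gradNoise (hl : IsLossFamily D f) (hs : IsSmoothFamily β D f)
    (ho : IsOracle υ D f) (i : Fin n) (θ : EuclideanSpace ℝ (Fin d)) :
    ∫ x, gradNoise D f i (θ, x) ∂(D i) = 0 := by
  have hI : Integrable (fun x => stochGrad f i θ x) (D i) := by
    refine ((integrable_gradNoise hl hs ho i θ).add
      (integrable_const (gradient (localLoss D f i) θ))).congr
      (Filter.Eventually.of_forall fun x => ?_)
    simp [gradNoise]
  simp only [gradNoise]
  rw [integral_sub hI (integrable_const _), ho.unbiased]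
  simp

end Gradients

/-! ### Moments and orthogonality of the noise along the iterates. -/

section Iterates

variable {n d : ℕ} {Ξ Ω : Type*} {f : Fin n → EuclideanSpace ℝ (Fin d) → Ξ → ℝ}
  {ξ : ℕ → Fin n → Ω → Ξ} {W : Matrix (Fin n) (Fin n) ℝ} {α : ℝ} {θ₀ : EuclideanSpace ℝ (Fin d)}

theorem isTracking_gtState (x : ℕ → Fin n → Ξ) :
    IsTracking W α θ₀ (fun t => (gtState W (fun _ => 1) α f θ₀ x t).1)
      (fun t => (gtState W (fun _ => 1) α f θ₀ x t).2)
      (fun t i => stochGrad f i ((gtState W (fun _ => 1) α f θ₀ x t).1 i) (x t i)) where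
  init_iterate := rfl
  init_tracker := by
    funext i
    simp [gtState]
  step_iterate _ := rfl
  step_tracker t := by
    funext i
    simp [gtState, mix]

/-- The iterate of node `i` after `t` rounds along the samples `ξ`, with unit gradient weights. -/
def iterate (W : Matrix (Fin n) (Fin n) ℝ) (α : ℝ)
    (f : Fin n → EuclideanSpace ℝ (Fin d) → Ξ → ℝ) (θ₀ : EuclideanSpace ℝ (Fin d))
    (ξ : ℕ → Fin n → Ω → Ξ) (t : ℕ) (i : Fin n) (ω : Ω) : EuclideanSpace ℝ (Fin d) :=
  (gtState W (fun _ => 1) α f θ₀ (fun k i => ξ k i ω) t).1 i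

variable [MeasurableSpace Ξ] {D : Fin n → Measure Ξ} {β υ : ℝ}

theorem measurable_iterate_otherSamples (hl : IsLossFamily D f) (t : ℕ) (i j : Fin n) :
    Measurable[otherSamples ξ t i] (iterate W α f θ₀ ξ t j) :=
  (@measurable_gtState n d Ω Ξ _ f W (fun _ => 1) α θ₀ (otherSamples ξ t i) ξ
    hl.measurable_grad t).1 (fun k hk l => measurable_otherSamples ξ fun h => by
      simp only [Prod.mk.injEq] at h
      omega) j

variable [mΩ : MeasurableSpace Ω] {P : Measure Ω}

theorem IsSampling.measurable_iterate (hξ : IsSampling P D ξ) (hl : IsLossFamily D f) (t : ℕ)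
    (i : Fin n) : Measurable (iterate W α f θ₀ ξ t i) :=
  (measurable_gtState hl.measurable_grad t).1 (fun k _ l => hξ.measurable k l) i

variable [∀ i, IsProbabilityMeasure (D i)] [IsProbabilityMeasure P]

theorem noise_iterate_memLp (hl : IsLossFamily D f) (hs : IsSmoothFamily β D f)
    (ho : IsOracle υ D f) (hξ : IsSampling P D ξ) (t : ℕ) (i : Fin n) :
    MemLp (fun ω => gradNoise D f i (iterate W α f θ₀ ξ t i ω, ξ t i ω)) 2 P ∧
      ∫ ω, ‖gradNoise D f i (iterate W α f θ₀ ξ t i ω, ξ t i ω)‖ ^ 2 ∂P ≤ υ ^ 2 :=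
  noise_secondMoment (hξ.measurable_iterate hl t i) (hξ.measurable t i) (hξ.law t i)
    (hξ.indepFun_of_otherSamples (measurable_iterate_otherSamples hl t i i))
    (measurable_gradNoise hl hs i) (ho.integrable_sq i) (ho.variance_le i)

/-- Pairing `X` with the iterate gives one variable independent of the fresh sample. `X` may use
every other sample, including those of other nodes in the same round, so this covers both the
past-dependent factor of the descent and the noise of another node. -/
theorem integral_inner_noise_iterate (hl : IsLossFamily D f)
    (hs : IsSmoothFamily β D f) (ho : IsOracle υ D f) (hξ : IsSampling P D ξ) (t : ℕ) (i : Fin n)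
    {X : Ω → EuclideanSpace ℝ (Fin d)} (hX : Measurable[otherSamples ξ t i] X) :
    ∫ ω, inner ℝ (X ω) (gradNoise D f i (iterate W α f θ₀ ξ t i ω, ξ t i ω)) ∂P = 0 := by
  have hu : Measurable[otherSamples ξ t i] fun ω => (X ω, iterate W α f θ₀ ξ t i ω) :=
    Measurable.prodMk hX (measurable_iterate_otherSamples hl t i i)
  have hZ : Measurable fun p : (EuclideanSpace ℝ (Fin d) × EuclideanSpace ℝ (Fin d)) × Ξ =>
      gradNoise D f i (p.1.2, p.2) :=
    (measurable_gradNoise hl hs i).comp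
      ((measurable_snd.comp measurable_fst).prodMk measurable_snd)
  have hum : Measurable fun ω => (X ω, iterate W α f θ₀ ξ t i ω) :=
    hu.mono (hξ.otherSamples_le t i) le_rfl
  exact integral_inner_noise_eq_zero hum (hξ.measurable t i) (hξ.law t i)
    (hξ.indepFun_of_otherSamples hu) hZ
    (fun w => integrable_gradNoise hl hs ho i w.2)
    (fun w => integral_gradNoise hl hs ho i w.2) (χ := Prod.fst) measurable_fst

theorem integral_inner_noise_noise (hl : IsLossFamily D f)
    (hs : IsSmoothFamily β D f) (ho : IsOracle υ D f) (hξ : IsSampling P D ξ) (t : ℕ)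
    {i j : Fin n} (hij : i ≠ j) :
    ∫ ω, inner ℝ (gradNoise D f i (iterate W α f θ₀ ξ t i ω, ξ t i ω))
      (gradNoise D f j (iterate W α f θ₀ ξ t j ω, ξ t j ω)) ∂P = 0 :=
  integral_inner_noise_iterate hl hs ho hξ t j
    ((measurable_gradNoise hl hs i).comp
      (Measurable.prodMk (measurable_iterate_otherSamples hl t j i)
        (measurable_otherSamples ξ fun h => hij (Prod.ext_iff.1 h).2)))

theorem memLp_stochGrad_iterate (hl : IsLossFamily D f) (hs : IsSmoothFamily β D f)
    (ho : IsOracle υ D f) (hξ : IsSampling P D ξ) {t : ℕ} {i : Fin n}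
    (h : MemLp (iterate W α f θ₀ ξ t i) 2 P) :
    MemLp (fun ω => stochGrad f i (iterate W α f θ₀ ξ t i ω) (ξ t i ω)) 2 P := by
  refine ((noise_iterate_memLp (W := W) (α := α) (θ₀ := θ₀) hl hs ho hξ t i).1.add
    (memLp_comp_of_lipschitz (hs.lipschitz i) h)).ae_eq
    (Filter.Eventually.of_forall fun ω => ?_)
  simp [gradNoise]

theorem memLp_gtState (hl : IsLossFamily D f) (hs : IsSmoothFamily β D f)
    (ho : IsOracle υ D f) (hξ : IsSampling P D ξ) (t : ℕ) :
    (∀ i, MemLp (iterate W α f θ₀ ξ t i) 2 P) ∧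
    ∀ i, MemLp (fun ω => (gtState W (fun _ => 1) α f θ₀ (fun k i => ξ k i ω) t).2 i) 2 P := by
  induction t with
  | zero =>
    have h0 : ∀ i, MemLp (iterate W α f θ₀ ξ 0 i) 2 P := fun i => memLp_const θ₀
    exact ⟨h0, fun i => (memLp_stochGrad_iterate hl hs ho hξ (h0 i)).const_smul (1 : ℝ)⟩
  | succ t ih =>
    have h1 : ∀ i, MemLp (iterate W α f θ₀ ξ (t + 1) i) 2 P := fun i =>
      memLp_finsetSum Finset.univ fun j _ => ((ih.1 j).sub ((ih.2 j).const_smul α)).const_smul (W i j)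
    exact ⟨h1, fun i =>
      (memLp_finsetSum Finset.univ fun j _ => (ih.2 j).const_smul (W i j)).add
        (((memLp_stochGrad_iterate hl hs ho hξ (h1 i)).sub
          (memLp_stochGrad_iterate hl hs ho hξ (ih.1 i))).const_smul (1 : ℝ))⟩

end Iterates

-- Expected bound and choice of the step size.

universe u v

/-- The expected squared gradients along the averaged trajectory, for small step sizes. -/
theorem exists_sum_integral_gradient_sq_le {n : ℕ} {s : Strategy} {G : SimpleGraph (Fin n)}
    {W : Matrix (Fin n) (Fin n) ℝ} {β : ℝ} (υ Δ : ℝ) (hG : G.Connected)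
    (hW : IsMixingMatrix s G (fun _ => 1) W) (hβ : 0 < β) :
    ∃ M a : ℝ, 0 < M ∧ 0 < a ∧ ∀ (d : ℕ) (Ξ : Type u) [MeasurableSpace Ξ] (D : Fin n → Measure Ξ)
      [∀ i, IsProbabilityMeasure (D i)] (f : Fin n → EuclideanSpace ℝ (Fin d) → Ξ → ℝ)
      (θ₀ : EuclideanSpace ℝ (Fin d)), IsLossFamily D f → IsSmoothFamily β D f → IsOracle υ D f →
      (∀ θ, globalLoss (fun _ => 1) D f θ₀ - globalLoss (fun _ => 1) D f θ ≤ Δ) →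
      ∀ (Ω : Type v) [MeasurableSpace Ω] (P : Measure Ω) [IsProbabilityMeasure P]
        (ξ : ℕ → Fin n → Ω → Ξ), IsSampling P D ξ → ∀ α : ℝ, 0 < α → α ^ 2 ≤ a → ∀ T : ℕ,
        (∀ t, Integrable (fun ω => ‖gradient (globalLoss (fun _ => 1) D f)
          (gtAverage s (fun _ => 1) W α f θ₀ (fun k i => ξ k i ω) t)‖ ^ 2) P) ∧
        ∑ t ∈ Finset.range T, ∫ ω, ‖gradient (globalLoss (fun _ => 1) D f)
          (gtAverage s (fun _ => 1) W α f θ₀ (fun k i => ξ k i ω) t)‖ ^ 2 ∂P ≤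
        2 * Δ / α + M * α ^ 2 * (n * gradDispersion (fun _ => 1) D f θ₀ +
          (T + 2) * (n * υ ^ 2)) + β * α * (T * (υ ^ 2 / n)) := by
  have : NeZero n := ⟨by
    obtain ⟨i⟩ := hG.nonempty
    exact i.pos.ne'⟩
  have hn : (0 : ℝ) < n := by exact_mod_cast NeZero.pos n
  obtain ⟨M, a, hM, ha, hpath⟩ := exists_sum_gradient_sq_le hG hW hβ
  refine ⟨M, a, hM, ha, ?_⟩
  intro d Ξ _ D _ f θ₀ hl hs ho hΔ Ω _ P _ ξ hξ α hα hαa T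
  have hgain : gain s (fun _ : Fin n => 1) = fun _ => 1 := by cases s <;> rfl
  set Θ : ℕ → Fin n → Ω → EuclideanSpace ℝ (Fin d) := iterate W α f θ₀ ξ
  set F := globalLoss (fun _ => 1) D f
  set e : ℕ → Fin n → Ω → EuclideanSpace ℝ (Fin d) :=
    fun t i ω => gradNoise D f i (Θ t i ω, ξ t i ω)
  have havg : ∀ t ω, gtAverage s (fun _ => 1) W α f θ₀ (fun k i => ξ k i ω) t =
      avg fun i => Θ t i ω := by
    intro t ω
    rw [gtAverage, hgain]
    rfl
  simp only [havg]
  have hΘ2 : ∀ t i, MemLp (Θ t i) 2 P := fun t => (memLp_gtState hl hs ho hξ t).1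
  have he2 : ∀ t i, MemLp (e t i) 2 P := fun t i => (noise_iterate_memLp hl hs ho hξ t i).1
  have hev : ∀ t i, ∫ ω, ‖e t i ω‖ ^ 2 ∂P ≤ υ ^ 2 := fun t i =>
    (noise_iterate_memLp hl hs ho hξ t i).2
  have hgF : ∀ t, MemLp (fun ω => gradient F (avg fun i => Θ t i ω)) 2 P := fun t =>
    memLp_comp_of_lipschitz hs.lipschitz_globalLoss (memLp_avg (hΘ2 t))
  have hgL : ∀ t i, MemLp (fun ω => gradient (localLoss D f i) (Θ t i ω)) 2 P := fun t i =>
    memLp_comp_of_lipschitz (hs.lipschitz i) (hΘ2 t i)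
  have hsq : ∀ {u : Ω → EuclideanSpace ℝ (Fin d)}, MemLp u 2 P →
      Integrable (fun ω => ‖u ω‖ ^ 2) P := fun hu => (memLp_two_iff_integrable_sq_norm hu.1).1 hu
  set X : ℕ → Ω → EuclideanSpace ℝ (Fin d) := fun t ω =>
    (2 : ℝ) • gradient F (avg fun i => Θ t i ω) -
      (2 * β * α) • avg fun i => gradient (localLoss D f i) (Θ t i ω)
  have hX2 : ∀ t, MemLp (X t) 2 P := fun t =>
    ((hgF t).const_smul (2 : ℝ)).sub ((memLp_avg (hgL t)).const_smul (2 * β * α))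
  have hXm : ∀ t i, Measurable[otherSamples ξ t i] (X t) := by
    intro t i
    have hm : ∀ j, Measurable[otherSamples ξ t i] (Θ t j) := measurable_iterate_otherSamples hl t i
    have hloc := fun j => (hs.continuous_gradient j).measurable
    have hglob : Measurable (gradient F) := by
      have : gradient F = fun θ => avg fun i => gradient (localLoss D f i) θ :=
        funext hs.gradient_globalLoss
      rw [this]
      exact (Finset.measurable_sum _ fun j _ => hloc j).const_smul (1 / (n : ℝ))
    have h1 : Measurable[otherSamples ξ t i] fun ω => avg fun j => Θ t j ω :=
      (Finset.measurable_sum _ fun j _ => hm j).const_smul (1 / (n : ℝ))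
    have h2 : Measurable[otherSamples ξ t i] fun ω =>
        avg fun j => gradient (localLoss D f j) (Θ t j ω) :=
      (Finset.measurable_sum _ fun j _ => (hloc j).comp (hm j)).const_smul (1 / (n : ℝ))
    exact ((hglob.comp h1).const_smul (2 : ℝ)).sub (h2.const_smul (2 * β * α))
  have hXe : ∀ t, ∫ ω, inner ℝ (X t ω) (avg fun i => e t i ω) ∂P = 0 := fun t =>
    integral_inner_avg_eq_zero (hX2 t) (he2 t) fun i =>
      integral_inner_noise_iterate hl hs ho hξ t i (hXm t i)
  have hbar : ∀ t, ∫ ω, ‖avg fun i => e t i ω‖ ^ 2 ∂P ≤ υ ^ 2 / n := fun t =>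
    integral_norm_avg_sq_le (he2 t) (hev t) fun i j hij =>
      integral_inner_noise_noise hl hs ho hξ t hij
  have hNint : ∀ t, Integrable (fun ω => ∑ i, ‖e t i ω‖ ^ 2) P := fun t =>
    integrable_finsetSum _ fun i _ => hsq (he2 t i)
  have hNle : ∀ t, ∫ ω, ∑ i, ‖e t i ω‖ ^ 2 ∂P ≤ n * υ ^ 2 := by
    intro t
    rw [integral_finsetSum _ fun i _ => hsq (he2 t i)]
    refine (Finset.sum_le_sum fun i _ => hev t i).trans (le_of_eq ?_)
    simp
  have hdisp : ∑ i, ‖gradient (localLoss D f i) θ₀ - gradient F θ₀‖ ^ 2 =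
      n * gradDispersion (fun _ => 1) D f θ₀ := by
    simp only [gradDispersion, one_mul]
    field_simp
    rfl
  have hineq : ∀ ω, ∑ t ∈ Finset.range T, ‖gradient F (avg fun i => Θ t i ω)‖ ^ 2 ≤
      2 * Δ / α + M * α ^ 2 * (n * gradDispersion (fun _ => 1) D f θ₀ + ∑ i, ‖e 0 i ω‖ ^ 2 +
        ∑ t ∈ Finset.range (T + 1), ∑ i, ‖e t i ω‖ ^ 2) +
      β * α * ∑ t ∈ Finset.range T, ‖avg fun i => e t i ω‖ ^ 2 -
      ∑ t ∈ Finset.range T, inner ℝ (X t ω) (avg fun i => e t i ω) := by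
    intro ω
    rw [← hdisp]
    exact hpath d α Δ θ₀ _ _ _ (fun i => gradient (localLoss D f i)) F hα hαa
      (fun θ => (hs.hasGradientAt_globalLoss θ).differentiableAt) hs.lipschitz_globalLoss
      hs.lipschitz hs.gradient_globalLoss hΔ (isTracking_gtState fun k i => ξ k i ω) T
  have hbarint : ∀ t, Integrable (fun ω => ‖avg fun i => e t i ω‖ ^ 2) P := fun t =>
    hsq (memLp_avg (he2 t))
  have hXint : ∀ t, Integrable (fun ω => (inner ℝ (X t ω) (avg fun i => e t i ω) : ℝ)) P :=
    fun t => integrable_inner_of_memLp (hX2 t) (memLp_avg (he2 t))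
  have hI1 := (integrable_const (μ := P) (n * gradDispersion (fun _ => 1) D f θ₀)).add (hNint 0)
  have hI2 : Integrable (fun ω => ∑ t ∈ Finset.range (T + 1), ∑ i, ‖e t i ω‖ ^ 2) P :=
    integrable_finsetSum _ fun t _ => hNint t
  have hI3 : Integrable (fun ω => ∑ t ∈ Finset.range T, ‖avg fun i => e t i ω‖ ^ 2) P :=
    integrable_finsetSum _ fun t _ => hbarint t
  have hI4 : Integrable (fun ω =>
      ∑ t ∈ Finset.range T, (inner ℝ (X t ω) (avg fun i => e t i ω) : ℝ)) P :=
    integrable_finsetSum _ fun t _ => hXint t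
  refine ⟨fun t => hsq (hgF t), ?_⟩
  rw [← integral_finsetSum _ fun t _ => hsq (hgF t)]
  have hI12 := ((hI1.add hI2).const_mul (M * α ^ 2))
  have hI123 := ((integrable_const (μ := P) (2 * Δ / α)).add hI12).add (hI3.const_mul (β * α))
  refine (integral_mono (integrable_finsetSum _ fun t _ => hsq (hgF t)) (hI123.sub hI4)
    hineq).trans ?_
  rw [integral_sub' hI123 hI4,
    integral_add' ((integrable_const _).add hI12) (hI3.const_mul (β * α)),
    integral_add' (integrable_const _) hI12, integral_const_mul, integral_const_mul,
    integral_add' hI1 hI2, integral_add' (integrable_const _) (hNint 0),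
    integral_finsetSum _ fun t _ => hNint t, integral_finsetSum _ fun t _ => hbarint t,
    integral_finsetSum _ fun t _ => hXint t]
  simp only [integral_const, probReal_univ, one_smul, hXe, Finset.sum_const_zero, sub_zero]
  have h1 := Finset.sum_le_sum fun t (_ : t ∈ Finset.range (T + 1)) => hNle t
  have h2 := Finset.sum_le_sum fun t (_ : t ∈ Finset.range T) => hbar t
  simp only [Finset.sum_const, Finset.card_range, nsmul_eq_mul] at h1 h2
  push_cast at h1
  refine add_le_add (add_le_add le_rfl (mul_le_mul_of_nonneg_left ?_ (by positivity)))
    (mul_le_mul_of_nonneg_left h2 (by positivity))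
  -- The `T + 2` noise terms are the rounds `0, …, T` and a second copy of round `0`, from the
  -- initial tracker.
  linarith [hNle 0]

/-- With step size `n / √(nT)`, the bound is of order `1 / √(nT)` once `T` is large. -/
theorem rate_le {n T β υ Δ M δ S : ℝ} (hn : 1 ≤ n) (hT : 1 ≤ T) (hM : 0 < M)
    (hTQ : (M * n ^ 3 * (|δ| + 3 * υ ^ 2)) ^ 2 ≤ T)
    (hS : S ≤ 2 * Δ / (n / Real.sqrt (n * T)) + M * (n / Real.sqrt (n * T)) ^ 2 *
      (n * δ + (T + 2) * (n * υ ^ 2)) + β * (n / Real.sqrt (n * T)) * (T * (υ ^ 2 / n))) :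
    1 / T * S ≤ (2 * |Δ| + β * υ ^ 2 + 1) / Real.sqrt (n * T) := by
  have hn0 : 0 < n := by linarith
  have hT0 : 0 < T := by linarith
  have hr : 0 < Real.sqrt (n * T) := by positivity
  have hr2 : Real.sqrt (n * T) ^ 2 = n * T := Real.sq_sqrt (by positivity)
  set r := Real.sqrt (n * T)
  have hTr : T = r ^ 2 / n := by field_simp; linarith
  have hQ : M * n ^ 3 * (|δ| + 3 * υ ^ 2) ≤ r := by
    refine Real.le_sqrt_of_sq_le (hTQ.trans ?_)
    nlinarith
  have h1 : n * δ + (T + 2) * (n * υ ^ 2) ≤ n * T * (|δ| + 3 * υ ^ 2) := by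
    have e1 : δ ≤ T * |δ| := (le_abs_self δ).trans (le_mul_of_one_le_left (abs_nonneg δ) hT)
    have e2 : (T + 2) * υ ^ 2 ≤ 3 * T * υ ^ 2 := by gcongr; linarith
    have := mul_le_mul_of_nonneg_left (add_le_add e1 e2) hn0.le
    linarith
  -- The only term involving `M`: it is of order `1 / r ^ 2`, and `hQ` trades one factor `r` for the
  -- network constant.
  have h2 : 1 / T * (M * (n / r) ^ 2 * (n * δ + (T + 2) * (n * υ ^ 2))) ≤ 1 / r := by
    calc 1 / T * (M * (n / r) ^ 2 * (n * δ + (T + 2) * (n * υ ^ 2)))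
        ≤ 1 / T * (M * (n / r) ^ 2 * (n * T * (|δ| + 3 * υ ^ 2))) := by gcongr
      _ = M * n ^ 3 * (|δ| + 3 * υ ^ 2) / r ^ 2 := by field_simp
      _ ≤ r / r ^ 2 := by gcongr
      _ = 1 / r := by field_simp
  have h3 : 1 / T * (2 * Δ / (n / r)) ≤ 2 * |Δ| / r := by
    have : 1 / T * (2 * Δ / (n / r)) = 2 * Δ / r := by
      rw [hTr]
      field_simp
    rw [this]
    gcongr
    exact le_abs_self Δ
  have h4 : 1 / T * (β * (n / r) * (T * (υ ^ 2 / n))) = β * υ ^ 2 / r := by field_simp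
  have h5 := mul_le_mul_of_nonneg_left hS (by positivity : 0 ≤ 1 / T)
  rw [add_div, add_div]
  linarith

end WeightedGT

end

theorem mainTheorem6 (β υ Δ : ℝ) (hβ : 0 < β) (hυ : 0 ≤ υ) :
    ∃ C : ℝ, 0 ≤ C ∧
      ∀ (n : ℕ) (G : SimpleGraph (Fin n)), G.Connected →
      ∀ (s : WeightedGT.Strategy) (W : Matrix (Fin n) (Fin n) ℝ),
        WeightedGT.IsMixingMatrix s G (fun _ => 1) W →
      ∃ (α : ℕ → ℝ) (T₀ : ℝ → ℕ), (∀ T, 0 < α T) ∧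
        ∀ (d : ℕ) (Ξ : Type*) [MeasurableSpace Ξ] (D : Fin n → Measure Ξ)
          [∀ i, IsProbabilityMeasure (D i)]
          (f : Fin n → EuclideanSpace ℝ (Fin d) → Ξ → ℝ) (θ₀ : EuclideanSpace ℝ (Fin d)),
          WeightedGT.IsLossFamily D f →
          WeightedGT.IsSmoothFamily β D f →
          WeightedGT.IsOracle υ D f →
          (∀ θ, WeightedGT.globalLoss (fun _ => 1) D f θ₀ -
            WeightedGT.globalLoss (fun _ => 1) D f θ ≤ Δ) →
        ∀ (Ω : Type*) [MeasurableSpace Ω] (P : Measure Ω) [IsProbabilityMeasure P]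
          (ξ : ℕ → Fin n → Ω → Ξ), WeightedGT.IsSampling P D ξ →
        ∀ T : ℕ, T₀ (WeightedGT.gradDispersion (fun _ => 1) D f θ₀) ≤ T →
          (∀ t < T, Integrable (fun ω =>
            ‖gradient (WeightedGT.globalLoss (fun _ => 1) D f)
              (WeightedGT.gtAverage s (fun _ => 1) W (α T) f θ₀
                (fun k i => ξ k i ω) t)‖ ^ 2) P) ∧
          1 / (T : ℝ) * ∑ t ∈ Finset.range T,
            ∫ ω, ‖gradient (WeightedGT.globalLoss (fun _ => 1) D f)
              (WeightedGT.gtAverage s (fun _ => 1) W (α T) f θ₀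
                (fun k i => ξ k i ω) t)‖ ^ 2 ∂P
            ≤ C / Real.sqrt (n * T) := by
  refine ⟨2 * |Δ| + β * υ ^ 2 + 1, by positivity, ?_⟩
  intro n G hG s W hW
  obtain ⟨M, a, hM, ha, h⟩ :=
    WeightedGT.exists_sum_integral_gradient_sq_le υ Δ hG hW hβ
  have hn : (1 : ℝ) ≤ n := by
    obtain ⟨i⟩ := hG.nonempty
    exact_mod_cast i.pos
  -- The value `1` at `T = 0` only secures positivity, since `T₀ ≥ 1`. The bound `n / a` gives `α ^
  -- 2 = n / T ≤ a`; the last entry is the threshold required by `rate_le`.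
  refine ⟨fun T => if T = 0 then 1 else n / Real.sqrt (n * T), fun δ => max 1 (max ⌈n / a⌉₊
    ⌈(M * n ^ 3 * (|δ| + 3 * υ ^ 2)) ^ 2⌉₊), ?_, ?_⟩
  · intro T
    dsimp only
    split_ifs with hT
    · exact one_pos
    · have : (0 : ℝ) < T := by positivity
      positivity
  intro d Ξ _ D _ f θ₀ hl hs ho hΔ Ω _ P _ ξ hξ T hT
  have hT1 : 1 ≤ T := (le_max_left _ _).trans hT
  have hTa : n / a ≤ T := Nat.ceil_le.1 ((le_max_left _ _).trans ((le_max_right _ _).trans hT))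
  have hTQ := Nat.ceil_le.1 ((le_max_right _ _).trans ((le_max_right _ _).trans hT))
  have hT1' : (1 : ℝ) ≤ T := by exact_mod_cast hT1
  have hα : 0 < n / Real.sqrt (n * T) := by positivity
  have hα2 : (n / Real.sqrt (n * T)) ^ 2 ≤ a := by
    rw [div_pow, Real.sq_sqrt (by positivity), div_le_iff₀ (by positivity)]
    rw [div_le_iff₀ ha] at hTa
    nlinarith
  simp only [if_neg (Nat.one_le_iff_ne_zero.1 hT1)]
  obtain ⟨h1, h2⟩ := h d Ξ D f θ₀ hl hs ho hΔ Ω P ξ hξ _ hα hα2 T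
  exact ⟨fun t _ => h1 t, WeightedGT.rate_le hn hT1' hM hTQ h2⟩
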